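/- Let $n\geq 2$ be an integer and $a=\exp\left(\frac{2\pi i}{2n}\right)$. Consider the complex $2n\times 2n$ matrices \[ D=\mathrm{diag}(1,a,a^2,\ldots,a^{2n-1}),\qquad S=\begin{pmatrix}0&1&&\\&\ddots&\ddots&\\&&\ddots&1\\1&&&0\end{pmatrix} \] as supermatrices on an $(n|n)$-dimensional superspace in the alternating format (even, odd, even, odd, ...), so that $D$ is even and $S$ is odd. Let $[\cdot,\cdot]$ be the supercommutator, $\mathrm{ad}\,x(y)=[x,y]$, and let $\mathfrak{sl}(n|n)$ be the Lie superalgebra of supermatrices of supertrace $0$. For $1\le k\le 2n$ put \[ T_m^k=(\mathrm{ad}\,D)^{k-1}(\mathrm{ad}\,S)^{m-1}([D,S])\quad(1\le m\le 2n-1),\qquad T_{2n}^k=[S,T_{2n-1}^k]. \] Then $D$ and $S$ generate the Lie superalgebra $\mathfrak{sl}(n|n)$, and \[ \mathfrak{sl}(n|n)=\mathrm{Span}\left(D,\,S,\,T_m^k \;\middle|\; 1\le k,m\le 2n,\ k\ne 2n \text{ for } m=1,\ k\neq 1\text{ for } m=2n\right). \] Among these elements $T_{2n}^n=0$, and the remaining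 ones form a basis of $\mathfrak{sl}(n|n)$. A defining set of relations is given by (1)-(6) below; that is, they hold in $\mathfrak{sl}(n|n)$, and the kernel of the surjective homomorphism onto $\mathfrak{sl}(n|n)$ from the free Lie superalgebra on an even generator $D$ and an odd generator $S$ is the ideal generated by them (where $T_m^k$ is given by the same iterated superbrackets of the free generators): \begin{align*} (1)\quad& (\mathrm{ad}\,D)^{2n}(S)=(1-a)^{2n}S,\\ (2)\quad& (\mathrm{ad}\,D)^{2n}(\mathrm{ad}\,S)^{m-1}([D,S])=(1-a^m)^{2n}(\mathrm{ad}\,S)^{m-1}([D,S])\qquad(2\le m\le 2n-1),\\ (3)\quad& [S,T_{2n-1}^1]=(-1)^{n+1}(1-a^2)^n D,\\ (4)\quad& [S,T_{2n}^k]=(a^2-1)^{n-1}(a^{2k}-1)\left(\frac{1-a^{2n-1}}{1-a}\right)^{k-1}T_1^k\qquad(2\le k\le 2n),\\ (5)\quad& [S,S]=\frac{2}{(1-a^2)^{2n}}\,T_2^{2n}, \end{align*} and, for each $T_m^k$ with $2\le m\le 2n-1$, $1\le k\le 2n$, the $m-1$ relations \[ (6)\quad (\mathrm{ad}\,S)^{s_1}(T_{s_2+1}^k)=\left(\frac{1-a^{s_2+1}}{1-a^{m}}\right)^{k-1}c\;T_m^k,\qquad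 s_1+s_2=m-1,\quad s_1=1,\ldots,m-1, \] with \[ c=\begin{cases} \left(\frac{a^{2k}-1}{a^2-1}\right)^{\frac{s_1-1}{2}}\frac{a^k+1}{a+1} & s_1 \text{ odd},\ s_2\text{ even},\\[1ex] \left(\frac{a^{2k}-1}{a^2-1}\right)^{\frac{s_1-1}{2}}\frac{a^k-1}{a-1} & s_1,s_2 \text{ odd},\\[1ex] \left(\frac{a^{2k}-1}{a^2-1}\right)^{\frac{s_1}{2}} & s_1\text{ even}. \end{cases} \] -/

import Mathlib

noncomputable section

/-! ### Lie superalgebras over the complex numbers -/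

/-- The Koszul sign `(-1)^(i j)` of two parities. -/
def koszul (i j : ZMod 2) : ℂ := if i = 1 ∧ j = 1 then -1 else 1

/-- A complex Lie superalgebra: a space `L = L₀ ⊕ L₁` with an even bilinear superbracket which is
super-antisymmetric and satisfies the super Jacobi identity. -/
class LieSuperalgebra (L : Type*) [AddCommGroup L] [Module ℂ L] where
  /-- the even (`0`) and the odd (`1`) part -/
  part : ZMod 2 → Submodule ℂ L
  isCompl_part : IsCompl (part 0) (part 1)
  /-- the superbracket -/
  bracket : L →ₗ[ℂ] L →ₗ[ℂ] L
  bracket_mem : ∀ i j x y, x ∈ part i → y ∈ part j → bracket x y ∈ part (i + j)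
  bracket_skew : ∀ i j x y, x ∈ part i → y ∈ part j →
    bracket x y = -(koszul i j • bracket y x)
  jacobi : ∀ i j l x y z, x ∈ part i → y ∈ part j → z ∈ part l →
    bracket x (bracket y z) = bracket (bracket x y) z + koszul i j • bracket y (bracket x z)

namespace LieSuperalgebra

section

variable {L : Type*} [AddCommGroup L] [Module ℂ L] [LieSuperalgebra L]

/-- The adjoint operator `y ↦ [x, y]`. -/
def ad (x : L) : Module.End ℂ L := bracket x

/-- `W = (W ∩ L₀) ⊕ (W ∩ L₁)`. -/
def IsGraded (W : Submodule ℂ L) : Prop := W = (W ⊓ part 0) ⊔ (W ⊓ part 1)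

/-- Sub-superalgebras. -/
def IsSubalgebra (W : Submodule ℂ L) : Prop :=
  IsGraded W ∧ ∀ x ∈ W, ∀ y ∈ W, ad x y ∈ W

/-- Ideals (two-sided, by super-antisymmetry). -/
def IsIdeal (I : Submodule ℂ L) : Prop :=
  IsGraded I ∧ ∀ x, ∀ y ∈ I, ad x y ∈ I

/-- The sub-superalgebra generated by a set. -/
def generated (R : Set L) : Submodule ℂ L :=
  sInf {W | R ⊆ W ∧ IsSubalgebra W}

/-- The ideal generated by a set. -/
def idealGenerated (R : Set L) : Submodule ℂ L :=
  sInf {I | R ⊆ I ∧ IsIdeal I}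

end

end LieSuperalgebra

/-! ### The free Lie superalgebra -/

namespace FreeLieSuper

variable {X : Type*}

/-- The parity of a nonassociative word in letters of given parities. -/
def wordParity (p : X → ZMod 2) : FreeMagma X → ZMod 2
  | .of x => p x
  | .mul u v => wordParity p u + wordParity p v

/-- The free nonassociative algebra: formal linear combinations of nonassociative words. -/
abbrev Pre (X : Type*) := FreeMagma X →₀ ℂ

/-- The product of the free nonassociative algebra, extending the product of words. -/
def mulPre : Pre X →ₗ[ℂ] Pre X →ₗ[ℂ] Pre X :=
  Finsupp.linearCombination ℂ (fun u => Finsupp.lmapDomain ℂ ℂ (fun v => u * v))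

/-- A word, as an element of the free nonassociative algebra. -/
def word (u : FreeMagma X) : Pre X := Finsupp.single u 1

lemma mulPre_word (u v : FreeMagma X) : mulPre (word u) (word v) = word (u * v) := by
  simp [mulPre, word]

/-- Super-antisymmetry and super Jacobi identity on words. -/
inductive Identity (p : X → ZMod 2) : Pre X → Prop
  | skew (u v : FreeMagma X) : Identity p
      (word (u * v) + koszul (wordParity p u) (wordParity p v) • word (v * u))
  | jacobi (u v w : FreeMagma X) : Identity p
      (word (u * (v * w)) - word ((u * v) * w)
        - koszul (wordParity p u) (wordParity p v) • word (v * (u * w)))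

/-- The two-sided ideal of the free nonassociative algebra generated by the identities. -/
def identityIdeal (p : X → ZMod 2) : Submodule ℂ (Pre X) :=
  sInf {I | (∀ r, Identity p r → r ∈ I) ∧ ∀ x, ∀ y ∈ I, mulPre x y ∈ I ∧ mulPre y x ∈ I}

lemma identity_mem (p : X → ZMod 2) {r : Pre X} (h : Identity p r) : r ∈ identityIdeal p := by
  simp only [identityIdeal, Submodule.mem_sInf]
  exact fun I hI => hI.1 r h

lemma mul_mem (p : X → ZMod 2) (x : Pre X) {y : Pre X} (h : y ∈ identityIdeal p) :
    mulPre x y ∈ identityIdeal p ∧ mulPre y x ∈ identityIdeal p := by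
  simp only [identityIdeal, Submodule.mem_sInf] at h ⊢
  exact ⟨fun I hI => (hI.2 x y (h I hI)).1, fun I hI => (hI.2 x y (h I hI)).2⟩

/-- The part of given parity of an element of the free nonassociative algebra. -/
def comp (p : X → ZMod 2) (i : ZMod 2) : Pre X →ₗ[ℂ] Pre X :=
  Finsupp.linearCombination ℂ (fun u => if wordParity p u = i then word u else 0)

lemma comp_word (p : X → ZMod 2) (i : ZMod 2) (u : FreeMagma X) :
    comp p i (word u) = if wordParity p u = i then word u else 0 := by
  simp [comp, word]

lemma pre_induction {P : Pre X → Prop} (h0 : P 0) (hadd : ∀ x y, P x → P y → P (x + y))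
    (hsmul : ∀ (c : ℂ) x, P x → P (c • x)) (hw : ∀ u, P (word u)) (x : Pre X) : P x := by
  induction x using Finsupp.induction_linear with
  | zero => exact h0
  | add f g hf hg => exact hadd _ _ hf hg
  | single u c => simpa [word] using hsmul c _ (hw u)

lemma wordParity_mul (p : X → ZMod 2) (u v : FreeMagma X) :
    wordParity p (u * v) = wordParity p u + wordParity p v := rfl

lemma comp_mul_left (p : X → ZMod 2) (i : ZMod 2) (u : FreeMagma X) (y : Pre X) :
    comp p i (mulPre (word u) y) = mulPre (word u) (comp p (i - wordParity p u) y) := by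
  induction y using pre_induction with
  | h0 => simp
  | hadd x y hx hy => simp [hx, hy]
  | hsmul c x hx => simp [hx]
  | hw v =>
    rw [mulPre_word, comp_word, comp_word]
    have : wordParity p (u * v) = i ↔ wordParity p v = i - wordParity p u := by
      rw [wordParity_mul, eq_sub_iff_add_eq']
    by_cases h : wordParity p v = i - wordParity p u
    · simp [this, h, mulPre_word]
    · simp [this, h]

lemma comp_mul_right (p : X → ZMod 2) (i : ZMod 2) (u : FreeMagma X) (y : Pre X) :
    comp p i (mulPre y (word u)) = mulPre (comp p (i - wordParity p u) y) (word u) := by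
  induction y using pre_induction with
  | h0 => simp
  | hadd x y hx hy => simp [hx, hy]
  | hsmul c x hx => simp [hx]
  | hw v =>
    rw [mulPre_word, comp_word, comp_word]
    have : wordParity p (v * u) = i ↔ wordParity p v = i - wordParity p u := by
      rw [wordParity_mul, eq_sub_iff_add_eq]
    by_cases h : wordParity p v = i - wordParity p u
    · simp [this, h, mulPre_word]
    · simp [this, h]

lemma comp_mem (p : X → ZMod 2) {x : Pre X} (hx : x ∈ identityIdeal p) (i : ZMod 2) :
    comp p i x ∈ identityIdeal p := by
  let K : Submodule ℂ (Pre X) := ⨅ i, (identityIdeal p).comap (comp p i)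
  have hK : ∀ z, z ∈ K ↔ ∀ i, comp p i z ∈ identityIdeal p := by
    intro z; simp [K, Submodule.mem_iInf]
  have hle : identityIdeal p ≤ K := by
    refine sInf_le ⟨?_, ?_⟩
    · intro r hr
      rw [hK]
      intro i
      cases hr with
      | skew u v =>
        have := identity_mem p (Identity.skew (p := p) u v)
        have h : wordParity p (v * u) = wordParity p (u * v) := by
          rw [wordParity_mul, wordParity_mul, add_comm]
        simp only [map_add, map_smul, comp_word, h]
        split_ifs
        · exact this
        · simp
      | jacobi u v w =>
        have := identity_mem p (Identity.jacobi (p := p) u v w)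
        have h : wordParity p ((u * v) * w) = wordParity p (u * (v * w)) := by
          simp only [wordParity_mul, add_assoc]
        have h' : wordParity p (v * (u * w)) = wordParity p (u * (v * w)) := by
          simp only [wordParity_mul, add_left_comm]
        simp only [map_sub, map_smul, comp_word, h, h']
        split_ifs
        · exact this
        · simp
    · intro x y hy
      rw [hK] at hy
      constructor
      · rw [hK]
        intro i
        induction x using pre_induction with
        | h0 => simp
        | hadd x y hx hy => simpa using add_mem hx hy
        | hsmul c x hx => simpa using Submodule.smul_mem _ c hx
        | hw u => rw [comp_mul_left]; exact (mul_mem p _ (hy _)).1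
      · rw [hK]
        intro i
        induction x using pre_induction with
        | h0 => simp
        | hadd x y hx hy => simpa using add_mem hx hy
        | hsmul c x hx => simpa using Submodule.smul_mem _ c hx
        | hw u => rw [comp_mul_right]; exact (mul_mem p _ (hy _)).2
  exact (hK x).1 (hle hx) i

end FreeLieSuper

open FreeLieSuper in
/-- The free Lie superalgebra on letters of parities `p`: the free nonassociative algebra modulo
super-antisymmetry and the super Jacobi identity. -/
abbrev FreeLieSuperalgebra {X : Type*} (p : X → ZMod 2) := Pre X ⧸ identityIdeal p

namespace FreeLieSuper

variable {X : Type*} (p : X → ZMod 2)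

/-- The class of a word in the free Lie superalgebra. -/
def mk (u : FreeMagma X) : FreeLieSuperalgebra p := (identityIdeal p).mkQ (word u)

/-- The superbracket, induced by the product of words. -/
def bracketF : FreeLieSuperalgebra p →ₗ[ℂ] FreeLieSuperalgebra p →ₗ[ℂ] FreeLieSuperalgebra p :=
  (identityIdeal p).liftQ
    (LinearMap.flip ((identityIdeal p).liftQ
      (LinearMap.flip (mulPre.compr₂ (identityIdeal p).mkQ)) (by
        intro y hy
        rw [LinearMap.mem_ker]
        refine LinearMap.ext fun x => ?_
        exact (Submodule.Quotient.mk_eq_zero _).2 (mul_mem p x hy).1)))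
    (by
      intro x hx
      rw [LinearMap.mem_ker]
      refine LinearMap.ext fun y => ?_
      obtain ⟨y, rfl⟩ := (identityIdeal p).mkQ_surjective y
      exact (Submodule.Quotient.mk_eq_zero _).2 (mul_mem p y hx).2)

lemma bracketF_mk (u v : FreeMagma X) : bracketF p (mk p u) (mk p v) = mk p (u * v) := by
  simp only [bracketF, mk, Submodule.mkQ_apply, Submodule.liftQ_apply, LinearMap.flip_apply,
    LinearMap.compr₂_apply, mulPre_word]

/-- The part of parity `i`, spanned by the words of parity `i`. -/
def partF (i : ZMod 2) : Submodule ℂ (FreeLieSuperalgebra p) :=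
  Submodule.span ℂ {x | ∃ u, wordParity p u = i ∧ x = mk p u}

/-- The projection to the part of parity `i`. -/
def projF (i : ZMod 2) : FreeLieSuperalgebra p →ₗ[ℂ] FreeLieSuperalgebra p :=
  (identityIdeal p).mapQ (identityIdeal p) (comp p i) (fun _ hx => comp_mem p hx i)

lemma projF_mk (i : ZMod 2) (u : FreeMagma X) :
    projF p i (mk p u) = if wordParity p u = i then mk p u else 0 := by
  simp only [projF, mk, Submodule.mkQ_apply, Submodule.mapQ_apply, comp_word]
  split_ifs <;> simp

lemma projF_of_mem {i j : ZMod 2} {x : FreeLieSuperalgebra p} (hx : x ∈ partF p i) :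
    projF p j x = if i = j then x else 0 := by
  induction hx using Submodule.span_induction with
  | mem x h =>
    obtain ⟨u, rfl, rfl⟩ := h
    exact projF_mk p j u
  | zero => simp
  | add x y _ _ hx hy => rw [map_add, hx, hy]; split_ifs <;> simp
  | smul c x _ hx => rw [map_smul, hx]; split_ifs <;> simp

/-- The free Lie superalgebra is a Lie superalgebra. -/
instance instFree : LieSuperalgebra (FreeLieSuperalgebra p) where
  part := partF p
  isCompl_part := by
    constructor
    · rw [Submodule.disjoint_def]
      intro x h0 h1
      have a := projF_of_mem p (j := 0) h0
      have b := projF_of_mem p (j := 0) h1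
      rw [if_pos rfl] at a
      rw [if_neg (by decide)] at b
      rw [← a, b]
    · rw [codisjoint_iff, eq_top_iff]
      rintro x -
      obtain ⟨x, rfl⟩ := (identityIdeal p).mkQ_surjective x
      induction x using pre_induction with
      | h0 => simp
      | hadd x y hx hy => rw [map_add]; exact add_mem hx hy
      | hsmul c x hx => rw [map_smul]; exact Submodule.smul_mem _ c hx
      | hw u =>
        have h : wordParity p u = 0 ∨ wordParity p u = 1 := by
          generalize wordParity p u = t
          revert t; decide
        rcases h with h | h
        · exact Submodule.mem_sup_left (Submodule.subset_span ⟨u, h, rfl⟩)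
        · exact Submodule.mem_sup_right (Submodule.subset_span ⟨u, h, rfl⟩)
  bracket := bracketF p
  bracket_mem := by
    intro i j x y hx hy
    induction hx, hy using Submodule.span_induction₂ with
    | mem_mem x y hx hy =>
      obtain ⟨u, rfl, rfl⟩ := hx
      obtain ⟨v, rfl, rfl⟩ := hy
      rw [bracketF_mk]
      exact Submodule.subset_span ⟨u * v, rfl, rfl⟩
    | zero_left => simp
    | zero_right => simp
    | add_left x y z _ _ _ hx hy => simpa using add_mem hx hy
    | add_right x y z _ _ _ hx hy => simpa using add_mem hx hy
    | smul_left c x y _ _ h => simpa using Submodule.smul_mem _ c h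
    | smul_right c x y _ _ h => simpa using Submodule.smul_mem _ c h
  bracket_skew := by
    intro i j x y hx hy
    induction hx, hy using Submodule.span_induction₂ with
    | mem_mem x y hx hy =>
      obtain ⟨u, rfl, rfl⟩ := hx
      obtain ⟨v, rfl, rfl⟩ := hy
      rw [bracketF_mk, bracketF_mk, eq_neg_iff_add_eq_zero]
      simp only [mk, ← map_smul, ← map_add]
      rw [Submodule.mkQ_apply, Submodule.Quotient.mk_eq_zero]
      exact identity_mem p (.skew u v)
    | zero_left => simp
    | zero_right => simp
    | add_left x y z _ _ _ hx hy => simp only [map_add, LinearMap.add_apply, hx, hy]; module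
    | add_right x y z _ _ _ hx hy => simp only [map_add, LinearMap.add_apply, hx, hy]; module
    | smul_left c x y _ _ h => simp only [map_smul, LinearMap.smul_apply, h]; module
    | smul_right c x y _ _ h => simp only [map_smul, LinearMap.smul_apply, h]; module
  jacobi := by
    intro i j l x y z hx hy hz
    induction hz using Submodule.span_induction with
    | mem z hz =>
      obtain ⟨w, -, rfl⟩ := hz
      induction hx, hy using Submodule.span_induction₂ with
      | mem_mem x y hx hy =>
        obtain ⟨u, rfl, rfl⟩ := hx
        obtain ⟨v, rfl, rfl⟩ := hy
        simp only [bracketF_mk]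
        rw [← sub_eq_zero, ← sub_sub]
        simp only [mk, ← map_smul, ← map_sub]
        rw [Submodule.mkQ_apply, Submodule.Quotient.mk_eq_zero]
        exact identity_mem p (.jacobi u v w)
      | zero_left => simp
      | zero_right => simp
      | add_left x y z _ _ _ hx hy => simp only [map_add, LinearMap.add_apply, hx, hy]; module
      | add_right x y z _ _ _ hx hy => simp only [map_add, LinearMap.add_apply, hx, hy]; module
      | smul_left c x y _ _ h => simp only [map_smul, LinearMap.smul_apply, h]; module
      | smul_right c x y _ _ h => simp only [map_smul, LinearMap.smul_apply, h]; module
    | zero => simp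
    | add x y _ _ hx hy => simp only [map_add, hx, hy]; module
    | smul c x _ hx => simp only [map_smul, hx]; module

/-- The generators of the free Lie superalgebra. -/
def gen (x : X) : FreeLieSuperalgebra p := mk p (.of x)

section lift

variable {L : Type*} [AddCommGroup L] [Module ℂ L] [LieSuperalgebra L]

/-- The value of a word in a Lie superalgebra. -/
def evalWord (f : X → L) : FreeMagma X → L
  | .of x => f x
  | .mul u v => LieSuperalgebra.bracket (evalWord f u) (evalWord f v)

lemma evalWord_mem (f : X → L) (hf : ∀ x, f x ∈ LieSuperalgebra.part (p x)) (u : FreeMagma X) :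
    evalWord f u ∈ (LieSuperalgebra.part (wordParity p u) : Submodule ℂ L) := by
  induction u with
  | ih1 x => exact hf x
  | ih2 u v hu hv => exact LieSuperalgebra.bracket_mem _ _ _ _ hu hv

/-- The linear extension of `evalWord`. -/
def evalPre (f : X → L) : Pre X →ₗ[ℂ] L := Finsupp.linearCombination ℂ (evalWord f)

lemma evalPre_word (f : X → L) (u : FreeMagma X) : evalPre f (word u) = evalWord f u := by
  simp [evalPre, word]

lemma evalWord_mul (f : X → L) (u v : FreeMagma X) :
    evalWord f (u * v) = LieSuperalgebra.bracket (evalWord f u) (evalWord f v) := rfl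

lemma evalPre_mul (f : X → L) (x y : Pre X) :
    evalPre f (mulPre x y) = LieSuperalgebra.bracket (evalPre f x) (evalPre f y) := by
  induction x using pre_induction with
  | h0 => simp
  | hadd x y hx hy => simp [hx, hy]
  | hsmul c x hx => simp [hx]
  | hw u =>
    induction y using pre_induction with
    | h0 => simp
    | hadd x y hx hy => simp [hx, hy]
    | hsmul c x hx => simp [hx]
    | hw v => rw [mulPre_word, evalPre_word, evalPre_word, evalPre_word, evalWord_mul]

lemma identityIdeal_le_ker (f : X → L) (hf : ∀ x, f x ∈ LieSuperalgebra.part (p x)) :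
    identityIdeal p ≤ LinearMap.ker (evalPre f) := by
  refine sInf_le ⟨?_, ?_⟩
  · intro r hr
    rw [LinearMap.mem_ker]
    cases hr with
    | skew u v =>
      simp only [map_add, map_smul, evalPre_word, evalWord_mul]
      rw [LieSuperalgebra.bracket_skew _ _ _ _ (evalWord_mem p f hf u) (evalWord_mem p f hf v)]
      simp
    | jacobi u v w =>
      simp only [map_sub, map_smul, evalPre_word, evalWord_mul]
      rw [LieSuperalgebra.jacobi _ _ _ _ _ _ (evalWord_mem p f hf u) (evalWord_mem p f hf v)
        (evalWord_mem p f hf w)]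
      simp
  · intro x y hy
    rw [LinearMap.mem_ker] at hy
    simp [LinearMap.mem_ker, evalPre_mul, hy]

/-- The homomorphism from the free Lie superalgebra with given values on the generators. -/
def lift (f : X → L) (hf : ∀ x, f x ∈ LieSuperalgebra.part (p x)) :
    FreeLieSuperalgebra p →ₗ[ℂ] L :=
  (identityIdeal p).liftQ (evalPre f) (identityIdeal_le_ker p f hf)

lemma lift_gen (f : X → L) (hf : ∀ x, f x ∈ LieSuperalgebra.part (p x)) (x : X) :
    lift p f hf (gen p x) = f x := by
  simp only [lift, gen, mk, Submodule.mkQ_apply, Submodule.liftQ_apply, evalPre_word]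
  rfl

lemma lift_bracket (f : X → L) (hf : ∀ x, f x ∈ LieSuperalgebra.part (p x))
    (x y : FreeLieSuperalgebra p) :
    lift p f hf (LieSuperalgebra.bracket x y) =
      LieSuperalgebra.bracket (lift p f hf x) (lift p f hf y) := by
  obtain ⟨x, rfl⟩ := (identityIdeal p).mkQ_surjective x
  obtain ⟨y, rfl⟩ := (identityIdeal p).mkQ_surjective y
  exact evalPre_mul f x y

end lift

end FreeLieSuper

/-! ### Supermatrices in the alternating format -/

namespace SuperMatrix

variable (n : ℕ)

/-- `2n × 2n` complex matrices, on which the superspace structure of `gl(n|n)` in the alternating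
format (even, odd, even, odd, ...) is put below. -/
abbrev SMat := Matrix (Fin (2 * n)) (Fin (2 * n)) ℂ

variable {n}

/-- The parity of a row or column. -/
def par (r : Fin (2 * n)) : ZMod 2 := (r : ℕ)

/-- The component of parity `i` of a matrix. -/
def comp (i : ZMod 2) : SMat n →ₗ[ℂ] SMat n where
  toFun M := Matrix.of fun r c => if par r + par c = i then M r c else 0
  map_add' M N := by ext r c; simp only [Matrix.of_apply, Matrix.add_apply]; split_ifs <;> simp
  map_smul' k M := by
    ext r c; simp only [Matrix.of_apply, Matrix.smul_apply, RingHom.id_apply]; split_ifs <;> simp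

/-- The matrices of parity `i`. -/
def partM (i : ZMod 2) : Submodule ℂ (SMat n) where
  carrier := {M | ∀ r c, par r + par c ≠ i → M r c = 0}
  add_mem' := by intro M N hM hN r c h; simp [hM r c h, hN r c h]
  zero_mem' := by intro r c _; rfl
  smul_mem' := by intro k M hM r c h; simp [hM r c h]

lemma comp_of_mem {i : ZMod 2} {M : SMat n} (h : M ∈ partM i) (j : ZMod 2) :
    comp j M = if i = j then M else 0 := by
  ext r c
  simp only [comp, LinearMap.coe_mk, AddHom.coe_mk, Matrix.of_apply]
  by_cases hi : par r + par c = i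
  · by_cases hij : i = j
    · simp [hi, hij]
    · simp [hi, hij]
  · rw [h r c hi]
    split_ifs <;> simp [h r c hi]

/-- The supercommutator: the bilinear extension of `[M, N] = M N - (-1)^(i j) N M` for
`M`, `N` of parities `i`, `j`. -/
def bracketM : SMat n →ₗ[ℂ] SMat n →ₗ[ℂ] SMat n :=
  LinearMap.mk₂ ℂ
    (fun M N => M * N - ∑ i : ZMod 2, ∑ j : ZMod 2, koszul i j • (comp j N * comp i M))
    (by intro M M' N; simp only [map_add, add_mul, mul_add, smul_add, Finset.sum_add_distrib]; abel)
    (by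
      intro k M N
      simp only [map_smul, smul_mul_assoc, mul_smul_comm, smul_sub, Finset.smul_sum]
      simp only [smul_comm k])
    (by intro M N N'; simp only [map_add, add_mul, mul_add, smul_add, Finset.sum_add_distrib]; abel)
    (by
      intro k M N
      simp only [map_smul, smul_mul_assoc, mul_smul_comm, smul_sub, Finset.smul_sum]
      simp only [smul_comm k])

lemma bracketM_of_mem {i j : ZMod 2} {M N : SMat n} (hM : M ∈ partM i) (hN : N ∈ partM j) :
    bracketM M N = M * N - koszul i j • (N * M) := by
  simp only [bracketM, LinearMap.mk₂_apply, comp_of_mem hM, comp_of_mem hN]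
  rw [Finset.sum_eq_single i, Finset.sum_eq_single j]
  · simp
  · intro b _ hb
    simp [hb.symm]
  · simp
  · intro b _ hb
    simp [hb.symm]
  · simp

lemma mul_mem_part {i j : ZMod 2} {M N : SMat n} (hM : M ∈ partM i) (hN : N ∈ partM j) :
    M * N ∈ partM (i + j) := by
  intro r c h
  rw [Matrix.mul_apply]
  refine Finset.sum_eq_zero fun k _ => ?_
  by_cases h1 : par r + par k = i
  · by_cases h2 : par k + par c = j
    · exfalso
      apply h
      rw [← h1, ← h2]
      generalize par r = a
      generalize par k = b
      generalize par c = d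
      revert a b d
      decide
    · rw [hN k c h2, mul_zero]
  · rw [hM r k h1, zero_mul]

lemma bracketM_mem {i j : ZMod 2} {M N : SMat n} (hM : M ∈ partM i) (hN : N ∈ partM j) :
    bracketM M N ∈ partM (i + j) := by
  rw [bracketM_of_mem hM hN]
  refine sub_mem (mul_mem_part hM hN) (Submodule.smul_mem _ _ ?_)
  rw [add_comm]
  exact mul_mem_part hN hM

lemma koszul_comm (i j : ZMod 2) : koszul i j = koszul j i := by
  simp only [koszul, and_comm]

lemma zmod_two (i : ZMod 2) : i = 0 ∨ i = 1 := by
  revert i; decide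

lemma koszul_add (i j l : ZMod 2) : koszul i (j + l) = koszul i j * koszul i l := by
  rcases zmod_two i with rfl | rfl <;> rcases zmod_two j with rfl | rfl <;>
    rcases zmod_two l with rfl | rfl <;> simp [koszul, show (1 : ZMod 2) + 1 = 0 from rfl]

lemma koszul_eq (i j : ZMod 2) : koszul i j = 1 ∨ koszul i j = -1 := by
  unfold koszul; split_ifs <;> simp

/-- The Lie superalgebra `gl(n|n)` in the alternating format. -/
instance instMatrix : LieSuperalgebra (SMat n) where
  part := partM
  isCompl_part := by
    constructor
    · rw [Submodule.disjoint_def]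
      intro M h0 h1
      have a := comp_of_mem h0 0
      have b := comp_of_mem h1 0
      rw [if_pos rfl] at a
      rw [if_neg (by decide)] at b
      rw [← a, b]
    · rw [codisjoint_iff, eq_top_iff]
      rintro M -
      have h : M = comp 0 M + comp 1 M := by
        ext r c
        simp only [comp, LinearMap.coe_mk, AddHom.coe_mk, Matrix.add_apply, Matrix.of_apply]
        rcases zmod_two (par r + par c) with h | h <;> simp [h]
      have hm : ∀ i, comp i M ∈ partM i := by
        intro i r c hrc
        simp [comp, hrc]
      rw [h]
      exact Submodule.add_mem_sup (hm 0) (hm 1)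
  bracket := bracketM
  bracket_mem _ _ _ _ hM hN := bracketM_mem hM hN
  bracket_skew := by
    intro i j M N hM hN
    rw [bracketM_of_mem hM hN, bracketM_of_mem hN hM, koszul_comm j i]
    rcases koszul_eq i j with h | h <;> rw [h] <;> simp [add_comm]
  jacobi := by
    intro i j l M N K hM hN hK
    rw [bracketM_of_mem hM (bracketM_mem hN hK), bracketM_of_mem hN hK,
      bracketM_of_mem (bracketM_mem hM hN) hK, bracketM_of_mem hM hN,
      bracketM_of_mem hN (bracketM_mem hM hK), bracketM_of_mem hM hK,
      koszul_add, koszul_add, koszul_comm (i + j), koszul_add, koszul_comm l i, koszul_comm l j,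
      koszul_comm j i]
    rcases koszul_eq i j with h1 | h1 <;> rcases koszul_eq i l with h2 | h2 <;>
      rcases koszul_eq j l with h3 | h3 <;> rw [h1, h2, h3] <;>
      simp only [mul_one, mul_neg, neg_neg, one_smul, neg_smul] <;> noncomm_ring

variable (n)

/-- The supertrace: diagonal entries in odd positions count with a minus sign. -/
def supertrace : SMat n →ₗ[ℂ] ℂ :=
  ∑ r : Fin (2 * n), (-1 : ℂ) ^ (r : ℕ) • Matrix.entryLinearMap ℂ ℂ r r

/-- `sl(n|n)`: the supermatrices of supertrace zero. -/
def sl : Submodule ℂ (SMat n) := LinearMap.ker (supertrace n)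

/-- `a = exp(2πi/(2n))`. -/
def root : ℂ := Complex.exp (2 * Real.pi * Complex.I / ((2 * n : ℕ) : ℂ))

/-- The clock matrix `D = diag(1, a, ..., a^(2n-1))`. -/
def clock : SMat n := Matrix.diagonal fun r => root n ^ (r : ℕ)

/-- The shift matrix `S`: ones above the diagonal and in the lower left corner. -/
def shift : SMat n :=
  Matrix.of fun r c => if (c : ℕ) = ((r : ℕ) + 1) % (2 * n) then 1 else 0

lemma clock_mem : clock n ∈ (LieSuperalgebra.part 0 : Submodule ℂ (SMat n)) := by
  intro r c h
  refine Matrix.diagonal_apply_ne _ ?_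
  rintro rfl
  exact h (CharTwo.add_self_eq_zero _)

lemma shift_mem : shift n ∈ (LieSuperalgebra.part 1 : Submodule ℂ (SMat n)) := by
  intro r c h
  simp only [shift, Matrix.of_apply, ite_eq_right_iff, one_ne_zero, imp_false]
  intro hc
  apply h
  have h2 : ((((r : ℕ) + 1) % (2 * n) : ℕ) : ZMod 2) = (((r : ℕ) + 1 : ℕ) : ZMod 2) := by
    rw [ZMod.natCast_eq_natCast_iff]
    exact (Nat.mod_modEq _ _).of_dvd (Dvd.intro _ rfl)
  simp only [par, hc, h2]
  push_cast
  rw [← add_assoc, CharTwo.add_self_eq_zero, zero_add]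

end SuperMatrix

/-! ### Sylvester's generators: iterated superbrackets and relations -/

namespace Sylvester

open LieSuperalgebra SuperMatrix

section

variable {L : Type*} [AddCommGroup L] [Module ℂ L] [LieSuperalgebra L]

/-- The iterated superbrackets `T_m^k` of two elements `d`, `s` (for `1 ≤ k, m ≤ 2n`):
`(ad d)^(k-1) (ad s)^(m-1) [d, s]` for `m < 2n`, and `[s, T_(2n-1)^k]` for `m = 2n`. -/
def T (n : ℕ) (d s : L) (m k : ℕ) : L :=
  if m = 2 * n then ad s ((ad d ^ (k - 1)) ((ad s ^ (2 * n - 2)) (ad d s)))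
  else (ad d ^ (k - 1)) ((ad s ^ (m - 1)) (ad d s))

/-- The coefficient of `T_m^k`, `m = s₁ + s₂ + 1`, in `(ad s)^(s₁) (T_(s₂+1)^k)`. -/
def coeff (n k s₁ s₂ : ℕ) : ℂ :=
  let a := root n
  ((1 - a ^ (s₂ + 1)) / (1 - a ^ (s₁ + s₂ + 1))) ^ (k - 1) *
    if Even s₁ then ((a ^ (2 * k) - 1) / (a ^ 2 - 1)) ^ (s₁ / 2)
    else if Even s₂ then
      ((a ^ (2 * k) - 1) / (a ^ 2 - 1)) ^ ((s₁ - 1) / 2) * ((a ^ k + 1) / (a + 1))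
    else ((a ^ (2 * k) - 1) / (a ^ 2 - 1)) ^ ((s₁ - 1) / 2) * ((a ^ k - 1) / (a - 1))

/-- The defining relations `lhs = rhs` between `d` and `s`. -/
inductive Relation (n : ℕ) (d s : L) : L → L → Prop
  | rel1 : Relation n d s ((ad d ^ (2 * n)) s) ((1 - root n) ^ (2 * n) • s)
  | rel2 (m : ℕ) (h2 : 2 ≤ m) (hm : m ≤ 2 * n - 1) : Relation n d s
      ((ad d ^ (2 * n)) ((ad s ^ (m - 1)) (ad d s)))
      ((1 - root n ^ m) ^ (2 * n) • (ad s ^ (m - 1)) (ad d s))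
  | rel3 : Relation n d s
      (ad s (T n d s (2 * n - 1) 1))
      (((-1) ^ (n + 1) * (1 - root n ^ 2) ^ n) • d)
  | rel4 (k : ℕ) (h2 : 2 ≤ k) (hk : k ≤ 2 * n) : Relation n d s
      (ad s (T n d s (2 * n) k))
      (((root n ^ 2 - 1) ^ (n - 1) * (root n ^ (2 * k) - 1) *
        ((1 - root n ^ (2 * n - 1)) / (1 - root n)) ^ (k - 1)) • T n d s 1 k)
  | rel5 : Relation n d s
      (ad s s)
      ((2 / (1 - root n ^ 2) ^ (2 * n)) • T n d s 2 (2 * n))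
  | path (m k s₁ s₂ : ℕ) (h2 : 2 ≤ m) (hm : m ≤ 2 * n - 1) (hk1 : 1 ≤ k) (hk : k ≤ 2 * n)
      (hs₁ : 1 ≤ s₁) (hs : s₁ + s₂ = m - 1) : Relation n d s
      ((ad s ^ s₁) (T n d s (s₂ + 1) k))
      (coeff n k s₁ s₂ • T n d s m k)

end

/-- The pairs `(m, k)` for which `T_m^k` is listed in the spanning set. -/
def indexSet (n : ℕ) : Set (ℕ × ℕ) :=
  {q | 1 ≤ q.1 ∧ q.1 ≤ 2 * n ∧ 1 ≤ q.2 ∧ q.2 ≤ 2 * n ∧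
    (q.1 = 1 → q.2 ≠ 2 * n) ∧ (q.1 = 2 * n → q.2 ≠ 1)}

/-- The two letters. -/
inductive Letter
  | D
  | S

/-- `D` is even and `S` is odd. -/
def letterParity : Letter → ZMod 2
  | .D => 0
  | .S => 1

/-- The free Lie superalgebra on an even generator and an odd generator. -/
abbrev Free := FreeLieSuperalgebra letterParity

/-- The even generator. -/
def freeD : Free := FreeLieSuper.gen letterParity .D

/-- The odd generator. -/
def freeS : Free := FreeLieSuper.gen letterParity .S

/-- The letters as supermatrices. -/
def letterMatrix (n : ℕ) : Letter → SMat n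
  | .D => clock n
  | .S => shift n

lemma letterMatrix_mem (n : ℕ) (x : Letter) :
    letterMatrix n x ∈ (part (letterParity x) : Submodule ℂ (SMat n)) := by
  cases x
  · exact clock_mem n
  · exact shift_mem n

/-- The homomorphism from the free Lie superalgebra to `gl(n|n)` with `D ↦ D`, `S ↦ S`. -/
def toMatrix (n : ℕ) : Free →ₗ[ℂ] SMat n :=
  FreeLieSuper.lift letterParity (letterMatrix n) (letterMatrix_mem n)

end Sylvester

end

/-
With `S D = a D S`, the elements `D` and `S` act on the matrices `D^k S^m` through
`[D, D^k S^m] = (1 - a^m) D^(k+1) S^m` and `[S, D^k S^m] = (a^k - (-1)^m) D^k S^(m+1)`. Hence every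
`T_m^k` of the list is a nonzero multiple of `D^k S^m`, except that `T_(2n)^n = 0` because `D^n`
anticommutes with `S`. All claims about `sl(n|n)` follow, since the matrices `D^k S^m` form a basis
of `gl(n|n)` and the supertrace singles out `D^n`.

Conversely, in a Lie superalgebra in which the relations hold, `T_m^k` can be rescaled for `m < 2n`
to elements `Y_m^k` on which `ad D` and `ad S` act by the same two formulas. The span of `D`, `S`
and the `T_m^k` is then stable under `ad D` and `ad S`, hence everything, once `[D, T_(2n)^k] = 0`
and `T_(2n)^n = 0` are known. For these two, the discrete Fourier transform in `k` turns `Y_m^k`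
into analogues of the matrix units, which are eigenvectors of `ad D`; comparing eigenvalues
determines enough of their brackets. So the quotient of the free Lie superalgebra by the relations
is spanned by a family whose image in `sl(n|n)` is linearly independent, and the kernel is no larger
than the ideal.
-/

noncomputable section

namespace LieSuperalgebra

section general

variable {L : Type*} [AddCommGroup L] [Module ℂ L] [LieSuperalgebra L]

lemma koszul_natCast (m p : ℕ) : koszul (m : ZMod 2) (p : ZMod 2) = (-1) ^ (m * p) := by
  simp only [koszul, ZMod.natCast_eq_one_iff_odd, ← Nat.odd_mul]
  split_ifs with h
  · exact h.neg_one_pow.symm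
  · exact (Nat.not_odd_iff_even.1 h).neg_one_pow.symm

lemma ad_mem {i j : ZMod 2} {x y : L} (hx : x ∈ part i) (hy : y ∈ part j) :
    ad x y ∈ (part (i + j) : Submodule ℂ L) := bracket_mem _ _ _ _ hx hy

lemma ad_smul_left (c : ℂ) (x y : L) : ad (c • x) y = c • ad x y := by
  simp only [ad, map_smul, LinearMap.smul_apply]

lemma ad_neg_left (x y : L) : ad (-x) y = -ad x y := by
  simp only [ad, map_neg, LinearMap.neg_apply]

lemma exists_part_add_part (x : L) :
    ∃ x₀ x₁ : L, x₀ ∈ part 0 ∧ x₁ ∈ part 1 ∧ x₀ + x₁ = x :=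
  Submodule.codisjoint_iff_exists_add_eq.1 isCompl_part.codisjoint x

lemma eq_zero_of_part_add_part {x₀ x₁ : L} (h₀ : x₀ ∈ (part 0 : Submodule ℂ L))
    (h₁ : x₁ ∈ (part 1 : Submodule ℂ L)) (h : x₀ + x₁ = 0) : x₀ = 0 ∧ x₁ = 0 := by
  have hx₀ : x₀ = 0 := Submodule.disjoint_def.1 isCompl_part.disjoint x₀ h₀
    (eq_neg_of_add_eq_zero_left h ▸ neg_mem h₁)
  exact ⟨hx₀, by rwa [hx₀, zero_add] at h⟩

lemma ad_ad {i j : ZMod 2} {x y : L} (hx : x ∈ part i) (hy : y ∈ part j) (z : L) :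
    ad x (ad y z) = ad (ad x y) z + koszul i j • ad y (ad x z) := by
  obtain ⟨z₀, z₁, h₀, h₁, rfl⟩ := exists_part_add_part z
  have e₀ := jacobi _ _ _ _ _ _ hx hy h₀
  have e₁ := jacobi _ _ _ _ _ _ hx hy h₁
  simp only [ad, map_add] at *
  rw [e₀, e₁]
  module

lemma ad_skew {m p : ℕ} {x y : L} (hx : x ∈ part (m : ZMod 2)) (hy : y ∈ part (p : ZMod 2)) :
    ad x y = -((-1 : ℂ) ^ (m * p) • ad y x) := by
  rw [← koszul_natCast]
  exact bracket_skew _ _ _ _ hx hy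

lemma ad_ad_left {m p : ℕ} {x y : L} (hx : x ∈ part (m : ZMod 2)) (hy : y ∈ part (p : ZMod 2))
    (z : L) : ad (ad x y) z = ad x (ad y z) - (-1 : ℂ) ^ (m * p) • ad y (ad x z) := by
  rw [ad_ad hx hy, koszul_natCast, add_sub_cancel_right]

lemma ad_ad_even {d x : L} {i : ZMod 2} (hd : d ∈ part 0) (hx : x ∈ part i) (z : L) :
    ad d (ad x z) = ad (ad d x) z + ad x (ad d z) := by
  simp [ad_ad hd hx, koszul]

lemma ad_self_even {d : L} (hd : d ∈ (part 0 : Submodule ℂ L)) : ad d d = 0 := by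
  have h : ad d d = -ad d d := by
    simpa using ad_skew (m := 0) (p := 0) (by simpa using hd) (by simpa using hd)
  have : (2 : ℂ) • ad d d = 0 := by rw [two_smul]; exact add_eq_zero_iff_eq_neg.2 h
  exact (smul_eq_zero.1 this).resolve_left two_ne_zero

lemma ad_ad_mem {W : Submodule ℂ L} {i j : ZMod 2} {x y : L} (hx : x ∈ part i) (hy : y ∈ part j)
    (hxW : ∀ w ∈ W, ad x w ∈ W) (hyW : ∀ w ∈ W, ad y w ∈ W) {w : L} (hw : w ∈ W) :
    ad (ad x y) w ∈ W := by
  rw [← add_sub_cancel_right (ad (ad x y) w) (koszul i j • ad y (ad x w)), ← ad_ad hx hy]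
  exact sub_mem (hxW _ (hyW _ hw)) (Submodule.smul_mem _ _ (hyW _ (hxW _ hw)))

lemma ad_mem_span {ι : Type*} {x : L} {v : ι → L}
    (hx : ∀ i, ad x (v i) ∈ Submodule.span ℂ (Set.range v)) {y : L}
    (hy : y ∈ Submodule.span ℂ (Set.range v)) : ad x y ∈ Submodule.span ℂ (Set.range v) :=
  (Submodule.span_le (p := (Submodule.span ℂ (Set.range v)).comap (ad x))).2
    (Set.range_subset_iff.2 hx) hy

lemma isGraded_iff {W : Submodule ℂ L} : IsGraded W ↔
    ∀ x₀ ∈ (part 0 : Submodule ℂ L), ∀ x₁ ∈ (part 1 : Submodule ℂ L), x₀ + x₁ ∈ W →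
      x₀ ∈ W ∧ x₁ ∈ W := by
  constructor
  · intro h x₀ h₀ x₁ h₁ hx
    rw [h] at hx
    obtain ⟨y₀, hy₀, y₁, hy₁, e⟩ := Submodule.mem_sup.1 hx
    obtain ⟨e₀, e₁⟩ := eq_zero_of_part_add_part (sub_mem h₀ hy₀.2) (sub_mem h₁ hy₁.2)
      (by rw [sub_add_sub_comm, e, sub_self])
    exact ⟨sub_eq_zero.1 e₀ ▸ hy₀.1, sub_eq_zero.1 e₁ ▸ hy₁.1⟩
  · intro h
    refine le_antisymm (fun x hx => ?_) (sup_le inf_le_left inf_le_left)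
    obtain ⟨x₀, x₁, h₀, h₁, rfl⟩ := exists_part_add_part x
    obtain ⟨hx₀, hx₁⟩ := h x₀ h₀ x₁ h₁ hx
    exact Submodule.add_mem_sup ⟨hx₀, h₀⟩ ⟨hx₁, h₁⟩

lemma isIdeal_idealGenerated (R : Set L) : IsIdeal (idealGenerated R) := by
  simp only [IsIdeal, isGraded_iff, idealGenerated, Submodule.mem_sInf]
  exact ⟨fun x₀ h₀ x₁ h₁ hx => ⟨fun I hI => (hI.2.1 x₀ h₀ x₁ h₁ (hx I hI)).1,
    fun I hI => (hI.2.1 x₀ h₀ x₁ h₁ (hx I hI)).2⟩, fun x y hy I hI => hI.2.2 x y (hy I hI)⟩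

lemma subset_idealGenerated (R : Set L) : R ⊆ idealGenerated R := fun _ hx =>
  Submodule.mem_sInf.2 fun _ hI => hI.1 hx

end general

section quotient

variable {L : Type*} [AddCommGroup L] [Module ℂ L] [LieSuperalgebra L]

lemma IsIdeal.ad_mem_of_part {I : Submodule ℂ L} (hI : IsIdeal I) {i j : ZMod 2} {x y : L}
    (hxi : x ∈ part i) (hyj : y ∈ part j) (hx : x ∈ I) : ad x y ∈ I := by
  rw [ad, bracket_skew _ _ _ _ hxi hyj]
  exact neg_mem (Submodule.smul_mem _ _ (hI.2 y x hx))

lemma IsIdeal.ad_mem_left {I : Submodule ℂ L} (hI : IsIdeal I) {x : L} (hx : x ∈ I) (y : L) :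
    ad x y ∈ I := by
  obtain ⟨x₀, x₁, h₀, h₁, rfl⟩ := exists_part_add_part x
  obtain ⟨y₀, y₁, k₀, k₁, rfl⟩ := exists_part_add_part y
  obtain ⟨m₀, m₁⟩ := isGraded_iff.1 hI.1 x₀ h₀ x₁ h₁ hx
  simp only [ad, map_add, LinearMap.add_apply]
  exact add_mem (add_mem (hI.ad_mem_of_part h₀ k₀ m₀) (hI.ad_mem_of_part h₁ k₀ m₁))
    (add_mem (hI.ad_mem_of_part h₀ k₁ m₀) (hI.ad_mem_of_part h₁ k₁ m₁))

/-- The superbracket of the quotient by an ideal. -/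
def quotientBracket (I : Submodule ℂ L) (hI : IsIdeal I) : (L ⧸ I) →ₗ[ℂ] (L ⧸ I) →ₗ[ℂ] (L ⧸ I) :=
  I.liftQ (I.mapQLinear I ∘ₗ bracket.codRestrict (I.compatibleMaps I) hI.2) fun _ hx =>
    LinearMap.mem_ker.2 <| Submodule.linearMap_qext _ <| LinearMap.ext fun y =>
      (Submodule.Quotient.mk_eq_zero _).2 (hI.ad_mem_left hx y)

lemma quotientBracket_mkQ (I : Submodule ℂ L) (hI : IsIdeal I) (x y : L) :
    quotientBracket I hI (I.mkQ x) (I.mkQ y) = I.mkQ (bracket x y) := rfl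

/-- The quotient of a Lie superalgebra by an ideal. It is not an instance, since it depends on the
proof that the subspace is an ideal. -/
@[reducible]
def quotient (I : Submodule ℂ L) (hI : IsIdeal I) : LieSuperalgebra (L ⧸ I) where
  part i := (part i).map I.mkQ
  isCompl_part := by
    constructor
    · rw [Submodule.disjoint_def]
      rintro _ ⟨x₀, h₀, rfl⟩ ⟨x₁, h₁, e⟩
      have h : x₀ + -x₁ ∈ I := by
        rw [← sub_eq_add_neg, ← Submodule.Quotient.eq]; exact e.symm
      exact (Submodule.Quotient.mk_eq_zero _).2
        (isGraded_iff.1 hI.1 x₀ h₀ (-x₁) (neg_mem h₁) h).1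
    · rw [codisjoint_iff, ← Submodule.map_sup, isCompl_part.sup_eq_top, Submodule.map_top,
        Submodule.range_mkQ]
  bracket := quotientBracket I hI
  bracket_mem := by
    rintro i j _ _ ⟨x, hx, rfl⟩ ⟨y, hy, rfl⟩
    exact ⟨_, bracket_mem i j x y hx hy, (quotientBracket_mkQ I hI x y).symm⟩
  bracket_skew := by
    rintro i j _ _ ⟨x, hx, rfl⟩ ⟨y, hy, rfl⟩
    rw [quotientBracket_mkQ, quotientBracket_mkQ, bracket_skew i j x y hx hy, map_neg, map_smul]
  jacobi := by
    rintro i j l _ _ _ ⟨x, hx, rfl⟩ ⟨y, hy, rfl⟩ ⟨z, hz, rfl⟩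
    simp only [quotientBracket_mkQ]
    rw [jacobi i j l x y z hx hy hz, map_add, map_smul]

end quotient

section homomorphism

variable {L L' : Type*} [AddCommGroup L] [Module ℂ L] [LieSuperalgebra L]
  [AddCommGroup L'] [Module ℂ L'] [LieSuperalgebra L'] {f : L →ₗ[ℂ] L'}

lemma map_ad_pow (hf : ∀ x y, f (ad x y) = ad (f x) (f y)) (x y : L) (k : ℕ) :
    f ((ad x ^ k) y) = (ad (f x) ^ k) (f y) := by
  induction k with
  | zero => simp
  | succ k ih => rw [pow_succ', Module.End.mul_apply, hf, ih, pow_succ', Module.End.mul_apply]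

lemma isIdeal_ker (hp : ∀ i, ∀ x ∈ part i, f x ∈ part i)
    (hf : ∀ x y, f (ad x y) = ad (f x) (f y)) : IsIdeal (LinearMap.ker f) := by
  refine ⟨isGraded_iff.2 fun x₀ h₀ x₁ h₁ hx => ?_, fun x y hy => ?_⟩
  · rw [LinearMap.mem_ker, map_add] at hx
    exact eq_zero_of_part_add_part (hp 0 x₀ h₀) (hp 1 x₁ h₁) hx
  · rw [LinearMap.mem_ker] at hy ⊢
    rw [hf, hy, map_zero]

lemma isSubalgebra_range (hp : ∀ i, ∀ x ∈ part i, f x ∈ part i)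
    (hf : ∀ x y, f (ad x y) = ad (f x) (f y)) : IsSubalgebra (LinearMap.range f) := by
  refine ⟨le_antisymm ?_ (sup_le inf_le_left inf_le_left), ?_⟩
  · rintro _ ⟨x, rfl⟩
    obtain ⟨x₀, x₁, h₀, h₁, rfl⟩ := exists_part_add_part x
    rw [map_add]
    exact Submodule.add_mem_sup ⟨⟨x₀, rfl⟩, hp 0 x₀ h₀⟩ ⟨⟨x₁, rfl⟩, hp 1 x₁ h₁⟩
  · rintro _ ⟨x, rfl⟩ _ ⟨y, rfl⟩
    exact ⟨ad x y, hf x y⟩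

end homomorphism

end LieSuperalgebra

namespace FreeLieSuper

open LieSuperalgebra

variable {X : Type*} (p : X → ZMod 2)

lemma mk_mem_part (u : FreeMagma X) :
    mk p u ∈ (part (wordParity p u) : Submodule ℂ (FreeLieSuperalgebra p)) :=
  Submodule.subset_span ⟨u, rfl, rfl⟩

lemma gen_mem_part (x : X) : gen p x ∈ (part (p x) : Submodule ℂ (FreeLieSuperalgebra p)) :=
  mk_mem_part p (.of x)

lemma mk_mul (u v : FreeMagma X) : mk p (u * v) = ad (mk p u) (mk p v) :=
  (bracketF_mk p u v).symm

lemma eq_top_of_mk_mem {V : Submodule ℂ (FreeLieSuperalgebra p)} (h : ∀ u, mk p u ∈ V) :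
    V = ⊤ := by
  refine Submodule.eq_top_iff'.2 fun x => ?_
  obtain ⟨x, rfl⟩ := (identityIdeal p).mkQ_surjective x
  induction x using pre_induction with
  | h0 => rw [map_zero]; exact zero_mem _
  | hadd x y hx hy => rw [map_add]; exact add_mem hx hy
  | hsmul c x hx => rw [map_smul]; exact Submodule.smul_mem _ c hx
  | hw u => exact h u

lemma eq_top_of_ad_gen_mem {V : Submodule ℂ (FreeLieSuperalgebra p)} (hgen : ∀ x, gen p x ∈ V)
    (had : ∀ x, ∀ y ∈ V, ad (gen p x) y ∈ V) : V = ⊤ := by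
  have ad_mk_mem (u : FreeMagma X) : ∀ y ∈ V, ad (mk p u) y ∈ V := by
    induction u with
    | ih1 x => exact had x
    | ih2 u v hu hv =>
      rw [mk_mul]
      exact fun y => ad_ad_mem (mk_mem_part p u) (mk_mem_part p v) hu hv
  refine eq_top_of_mk_mem p fun u => ?_
  induction u with
  | ih1 x => exact hgen x
  | ih2 u v _ hv => exact mk_mul p u v ▸ ad_mk_mem u _ hv

section lift

variable {L : Type*} [AddCommGroup L] [Module ℂ L] [LieSuperalgebra L] (f : X → L)
  (hf : ∀ x, f x ∈ part (p x))

lemma lift_mk (u : FreeMagma X) : lift p f hf (mk p u) = evalWord f u := evalPre_word f u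

lemma lift_ad (x y : FreeLieSuperalgebra p) :
    lift p f hf (ad x y) = ad (lift p f hf x) (lift p f hf y) := lift_bracket p f hf x y

lemma lift_mem_part (i : ZMod 2) (x : FreeLieSuperalgebra p) (hx : x ∈ part i) :
    lift p f hf x ∈ part i := by
  suffices (part i : Submodule ℂ (FreeLieSuperalgebra p)) ≤ (part i).comap (lift p f hf) from
    this hx
  refine Submodule.span_le.2 ?_
  rintro _ ⟨u, rfl, rfl⟩
  rw [SetLike.mem_coe, Submodule.mem_comap, lift_mk]
  exact evalWord_mem p f hf u

lemma range_lift : LinearMap.range (lift p f hf) = generated (Set.range f) := by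
  refine le_antisymm (le_sInf fun W ⟨hW, _, hadW⟩ => ?_)
    (sInf_le ⟨?_, isSubalgebra_range (lift_mem_part p f hf) (lift_ad p f hf)⟩)
  · have gen_mem (x : X) : lift p f hf (gen p x) ∈ W := lift_gen p f hf x ▸ hW ⟨x, rfl⟩
    refine LinearMap.range_le_iff_comap.2 (eq_top_of_ad_gen_mem p gen_mem fun x y hy => ?_)
    rw [Submodule.mem_comap, lift_ad]
    exact hadW _ (gen_mem x) _ hy
  · rintro _ ⟨x, rfl⟩
    exact ⟨gen p x, lift_gen p f hf x⟩

end lift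

end FreeLieSuper

namespace Sylvester

open LieSuperalgebra SuperMatrix

section functoriality

variable {L L' : Type*} [AddCommGroup L] [Module ℂ L] [LieSuperalgebra L]
  [AddCommGroup L'] [Module ℂ L'] [LieSuperalgebra L'] {f : L →ₗ[ℂ] L'}

lemma map_T (hf : ∀ x y, f (ad x y) = ad (f x) (f y)) (n : ℕ) (d s : L) (m k : ℕ) :
    f (T n d s m k) = T n (f d) (f s) m k := by
  unfold T
  split_ifs <;> simp only [hf, map_ad_pow hf]

lemma relation_map_iff (hf : ∀ x y, f (ad x y) = ad (f x) (f y)) {n : ℕ} {d s : L} {x' y' : L'} :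
    Relation n (f d) (f s) x' y' ↔ ∃ x y, Relation n d s x y ∧ f x = x' ∧ f y = y' := by
  constructor
  · rintro (_ | ⟨m, h2, hm⟩ | _ | ⟨k, h2, hk⟩ | _ | ⟨m, k, s₁, s₂, h2, hm, hk1, hk, hs₁, hs⟩)
    · exact ⟨_, _, .rel1, map_ad_pow hf .., map_smul ..⟩
    · exact ⟨_, _, .rel2 m h2 hm, by simp only [map_ad_pow hf, hf],
        by simp only [map_smul, map_ad_pow hf, hf]⟩
    · exact ⟨_, _, .rel3, by simp only [map_T hf, hf], map_smul ..⟩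
    · exact ⟨_, _, .rel4 k h2 hk, by simp only [map_T hf, hf], by simp only [map_smul, map_T hf]⟩
    · exact ⟨_, _, .rel5, hf .., by simp only [map_smul, map_T hf]⟩
    · exact ⟨_, _, .path m k s₁ s₂ h2 hm hk1 hk hs₁ hs, by simp only [map_ad_pow hf, map_T hf],
        by simp only [map_smul, map_T hf]⟩
  · rintro ⟨x, y, h, rfl, rfl⟩
    cases h <;> simp only [map_smul, map_T hf, map_ad_pow hf, hf] <;> constructor <;> assumption

/-- The elements `D`, `S` and `T_m^k` of the spanning set, without `T_{2n}^n`. -/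
def generatorFamily (n : ℕ) (d s : L) : Fin 2 ⊕ ↥(indexSet n \ {(2 * n, n)}) → L :=
  Sum.elim ![d, s] fun q => T n d s q.1.1 q.1.2

lemma map_comp_generatorFamily (hf : ∀ x y, f (ad x y) = ad (f x) (f y)) (n : ℕ) (d s : L) :
    f ∘ generatorFamily n d s = generatorFamily n (f d) (f s) := by
  funext i
  rcases i with i | q
  · fin_cases i <;> rfl
  · exact map_T hf n d s _ _

lemma range_generatorFamily (n : ℕ) (d s : L) : Set.range (generatorFamily n d s) =
    {d, s} ∪ (fun q : ℕ × ℕ => T n d s q.1 q.2) '' (indexSet n \ {(2 * n, n)}) := by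
  rw [generatorFamily, Set.Sum.elim_range, Set.image_eq_range, Matrix.range_cons,
    Matrix.range_cons, Matrix.range_empty, Set.union_empty, Set.singleton_union]

end functoriality

/-! ### Roots of unity and coefficients -/

section roots

variable {n : ℕ}

lemma zmod_natCast_ne_zero {k : ℕ} (h1 : 0 < k) (h2 : k < 2 * n) : (k : ZMod (2 * n)) ≠ 0 := by
  rw [Ne, ZMod.natCast_eq_zero_iff]
  exact Nat.not_dvd_of_pos_of_lt h1 h2

lemma natCast_two_mul_sub {k : ℕ} (hk : k ≤ 2 * n) :
    ((2 * n - k : ℕ) : ZMod (2 * n)) = -k := by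
  rw [Nat.cast_sub hk, ZMod.natCast_self, zero_sub]

section

variable [NeZero n]

lemma two_mul_pos : 0 < 2 * n := NeZero.pos (2 * n)

lemma isPrimitiveRoot_root : IsPrimitiveRoot (root n) (2 * n) :=
  Complex.isPrimitiveRoot_exp (2 * n) (NeZero.ne _)

lemma root_pow_two_mul : root n ^ (2 * n) = 1 := isPrimitiveRoot_root.pow_eq_one

lemma root_mul_root_pow_last : root n * root n ^ (2 * n - 1) = 1 := by
  rw [mul_pow_sub_one (NeZero.ne _), root_pow_two_mul]

lemma stdAddChar_natCast (k : ℕ) : ZMod.stdAddChar (k : ZMod (2 * n)) = root n ^ k := by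
  rw [← Int.cast_natCast, ZMod.stdAddChar_coe, root, ← Complex.exp_nat_mul]
  congr 1
  push_cast
  ring

lemma one_sub_root_pow_ne_zero {m : ℕ} (h1 : 1 ≤ m) (h2 : m < 2 * n) : 1 - root n ^ m ≠ 0 :=
  sub_ne_zero.2 (isPrimitiveRoot_root.pow_ne_one_of_pos_of_lt (Nat.one_le_iff_ne_zero.1 h1) h2).symm

lemma root_pow_half : root n ^ n = -1 :=
  (isPrimitiveRoot_root.pow two_mul_pos (mul_comm 2 n)).eq_neg_one_of_two_right

end

lemma neZero_of_two_le (hn : 2 ≤ n) : NeZero n := ⟨by omega⟩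

lemma root_sq_sub_one_ne_zero (hn : 2 ≤ n) : root n ^ 2 - 1 ≠ 0 := by
  have := neZero_of_two_le hn
  rw [← neg_sub, neg_ne_zero]
  exact one_sub_root_pow_ne_zero (by omega) (by omega)

lemma root_sub_sign_ne_zero (hn : 2 ≤ n) (j : ℕ) : root n - (-1) ^ j ≠ 0 := by
  refine fun h => root_sq_sub_one_ne_zero hn ?_
  rw [sub_eq_zero.1 h, ← pow_mul, mul_comm, pow_mul, neg_one_sq, one_pow, sub_self]

lemma one_sub_root_ne_zero (hn : 2 ≤ n) : 1 - root n ≠ 0 :=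
  sub_ne_zero.2 (sub_ne_zero.1 (by simpa using root_sub_sign_ne_zero hn 0)).symm

lemma prod_sub_sign_two_mul {R : Type*} [CommRing R] (x : R) (p t : ℕ) :
    ∏ j ∈ Finset.range (2 * t), (x - (-1) ^ (p + j)) = (x ^ 2 - 1) ^ t := by
  induction t with
  | zero => simp
  | succ t ih =>
    have sign_sq : ((-1 : R) ^ (p + 2 * t)) ^ 2 = 1 := by
      rw [← pow_mul, mul_comm, pow_mul, neg_one_sq, one_pow]
    rw [mul_add_one, Finset.prod_range_succ, Finset.prod_range_succ, ih, pow_succ _ t, mul_assoc]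
    congr 1
    rw [← add_assoc, pow_succ]
    linear_combination -sign_sq

lemma prod_sub_sign_two_mul_add_one {R : Type*} [CommRing R] (x : R) (p t : ℕ) :
    ∏ j ∈ Finset.range (2 * t + 1), (x - (-1) ^ (p + j)) = (x ^ 2 - 1) ^ t * (x - (-1) ^ p) := by
  rw [Finset.prod_range_succ, prod_sub_sign_two_mul, pow_add _ p, pow_mul, neg_one_sq, one_pow,
    mul_one]

variable (n) in
/-- The coefficient of `D S^m` in `(ad S)^(m-1) [D, S]`. -/
def leading (m : ℕ) : ℂ :=
  (1 - root n) * ∏ j ∈ Finset.range (m - 1), (root n - (-1) ^ (1 + j))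

lemma leading_ne_zero (hn : 2 ≤ n) (m : ℕ) : leading n m ≠ 0 :=
  mul_ne_zero (one_sub_root_ne_zero hn)
    (Finset.prod_ne_zero_iff.2 fun j _ => root_sub_sign_ne_zero hn (1 + j))

lemma leading_one : leading n 1 = 1 - root n := by simp [leading]

lemma leading_succ {m : ℕ} (hm : 1 ≤ m) :
    leading n (m + 1) = leading n m * (root n - (-1) ^ m) := by
  obtain ⟨m, rfl⟩ := Nat.exists_eq_add_of_le' hm
  rw [leading, leading, Nat.add_sub_cancel, Nat.add_sub_cancel, Finset.prod_range_succ, mul_assoc,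
    add_comm 1 m]

lemma leading_add (s₁ s₂ : ℕ) : leading n (s₁ + s₂ + 1) =
    leading n (s₂ + 1) * ∏ j ∈ Finset.range s₁, (root n - (-1) ^ (s₂ + 1 + j)) := by
  induction s₁ with
  | zero => simp
  | succ s₁ ih =>
    rw [add_right_comm s₁ 1 s₂, leading_succ (by omega), ih, Finset.prod_range_succ, mul_assoc,
      add_assoc s₁ s₂ 1, add_comm s₁ (s₂ + 1)]

/-- The scalar `c` in `T_m^k = c D^k S^m`, for `1 ≤ m < 2n` and `1 ≤ k`. -/
def scale (n m k : ℕ) : ℂ := leading n m * (1 - root n ^ m) ^ (k - 1)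

lemma scale_ne_zero (hn : 2 ≤ n) {m : ℕ} (h1 : 1 ≤ m) (h2 : m < 2 * n) (k : ℕ) :
    scale n m k ≠ 0 := by
  have := neZero_of_two_le hn
  exact mul_ne_zero (leading_ne_zero hn m) (pow_ne_zero _ (one_sub_root_pow_ne_zero h1 h2))

lemma scale_one_right (m : ℕ) : scale n m 1 = leading n m := by simp [scale]

lemma coeff_mul_scale (hn : 2 ≤ n) (k s₁ s₂ : ℕ) (h : s₁ + s₂ + 1 < 2 * n) :
    coeff n k s₁ s₂ * scale n (s₁ + s₂ + 1) k =
      scale n (s₂ + 1) k * ∏ j ∈ Finset.range s₁, (root n ^ k - (-1) ^ (s₂ + 1 + j)) := by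
  have := neZero_of_two_le hn
  have h1 : (1 - root n ^ (s₁ + s₂ + 1)) ^ (k - 1) ≠ 0 :=
    pow_ne_zero _ (one_sub_root_pow_ne_zero (by omega) h)
  have hm : root n - 1 ≠ 0 := by simpa using root_sub_sign_ne_zero hn 0
  have hp : root n + 1 ≠ 0 := by simpa using root_sub_sign_ne_zero hn 1
  simp only [coeff, scale, leading_add, div_pow, mul_comm 2 k, pow_mul (root n) k 2]
  obtain ⟨t, rfl | rfl⟩ := Nat.even_or_odd' s₁
  · have h2 : (root n ^ 2 - 1) ^ t ≠ 0 := pow_ne_zero _ (root_sq_sub_one_ne_zero hn)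
    rw [if_pos (even_two_mul t), prod_sub_sign_two_mul, prod_sub_sign_two_mul,
      Nat.mul_div_cancel_left t two_pos]
    field_simp
  · have h2 : (root n ^ 2 - 1) ^ t ≠ 0 := pow_ne_zero _ (root_sq_sub_one_ne_zero hn)
    rw [if_neg (Nat.not_even_two_mul_add_one t), prod_sub_sign_two_mul_add_one,
      prod_sub_sign_two_mul_add_one, Nat.add_sub_cancel, Nat.mul_div_cancel_left t two_pos]
    split_ifs with hs
    · rw [hs.add_one.neg_one_pow, sub_neg_eq_add, sub_neg_eq_add]
      field_simp
    · rw [(Nat.not_even_iff_odd.1 hs).add_one.neg_one_pow]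
      field_simp

lemma leading_last (hn : 1 ≤ n) :
    leading n (2 * n - 1) = (1 - root n) * (root n ^ 2 - 1) ^ (n - 1) := by
  rw [leading, show 2 * n - 1 - 1 = 2 * (n - 1) by omega, prod_sub_sign_two_mul]

end roots

end Sylvester

/-! ### Clock and shift matrices -/

namespace SuperMatrix

variable {n : ℕ}

lemma par_add_self (r : Fin (2 * n)) : par r + par r = 0 := CharTwo.add_self_eq_zero _

lemma one_mem_part : (1 : SMat n) ∈ (partM 0 : Submodule ℂ (SMat n)) := fun r _ h =>
  Matrix.one_apply_ne fun e => h (e ▸ par_add_self r)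

lemma pow_mem_part {i : ZMod 2} {M : SMat n} (hM : M ∈ partM i) (k : ℕ) :
    M ^ k ∈ partM (k • i) := by
  induction k with
  | zero => rw [pow_zero, zero_smul]; exact one_mem_part
  | succ k ih => rw [pow_succ, succ_nsmul]; exact mul_mem_part ih hM

end SuperMatrix

namespace Sylvester

open LieSuperalgebra SuperMatrix

lemma pow_mul_pow_of_mul_eq_smul {K A : Type*} [CommSemiring K] [Semiring A] [Algebra K A] {q : K}
    {x y : A} (h : x * y = q • (y * x)) (m k : ℕ) :
    x ^ m * y ^ k = q ^ (m * k) • (y ^ k * x ^ m) := by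
  have mul_pow_eq : x * y ^ k = q ^ k • (y ^ k * x) := by
    induction k with
    | zero => simp
    | succ k ih =>
      rw [pow_succ, ← mul_assoc, ih, smul_mul_assoc, mul_assoc, h, mul_smul_comm, smul_smul,
        ← mul_assoc, pow_succ]
  induction m with
  | zero => simp
  | succ m ih =>
    rw [pow_succ', mul_assoc, ih, mul_smul_comm, ← mul_assoc, mul_pow_eq, smul_mul_assoc, smul_smul,
      mul_assoc, add_one_mul, pow_add]

section matrices

/-- The matrix `D^k S^m`. -/
def clockShift (n m k : ℕ) : SMat n := clock n ^ k * shift n ^ m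

variable {n : ℕ}

lemma clock_pow (k : ℕ) :
    clock n ^ k = Matrix.diagonal fun r : Fin (2 * n) => root n ^ (k * (r : ℕ)) := by
  simp only [clock, Matrix.diagonal_pow, Pi.pow_def, ← pow_mul, mul_comm k]

lemma shift_pow_apply (m : ℕ) (r c : Fin (2 * n)) :
    (shift n ^ m) r c = if (c : ℕ) = ((r : ℕ) + m) % (2 * n) then 1 else 0 := by
  induction m generalizing c with
  | zero => simp [Matrix.one_apply, Fin.ext_iff, Nat.mod_eq_of_lt r.2, eq_comm]
  | succ m ih =>
    rw [pow_succ, Matrix.mul_apply,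
      Finset.sum_eq_single ⟨(r + m) % (2 * n), Nat.mod_lt _ (r.1.zero_le.trans_lt r.2)⟩]
    · rw [ih]
      simp [shift, add_assoc]
    · intro b _ hb
      rw [ih, if_neg (fun h => hb (Fin.ext h)), zero_mul]
    · simp

lemma clockShift_apply (m k : ℕ) (r c : Fin (2 * n)) : clockShift n m k r c =
    if (c : ℕ) = ((r : ℕ) + m) % (2 * n) then root n ^ (k * (r : ℕ)) else 0 := by
  rw [clockShift, clock_pow, Matrix.diagonal_mul, shift_pow_apply, mul_ite, mul_one, mul_zero]

lemma clockShift_mem (m k : ℕ) : clockShift n m k ∈ (part (m : ZMod 2) : Submodule ℂ (SMat n)) := by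
  have := mul_mem_part (pow_mem_part (clock_mem n) k) (pow_mem_part (shift_mem n) m)
  rwa [smul_zero, zero_add, nsmul_one] at this

lemma clockShift_zero_one : clockShift n 0 1 = clock n := by simp [clockShift]

lemma clockShift_one_zero : clockShift n 1 0 = shift n := by simp [clockShift]

lemma shift_pow_two_mul : shift n ^ (2 * n) = 1 := by
  ext r c
  simp [shift_pow_apply, Matrix.one_apply, Fin.ext_iff, Nat.mod_eq_of_lt r.2, eq_comm]

lemma clockShift_two_mul_left (k : ℕ) : clockShift n (2 * n) k = clockShift n 0 k := by
  rw [clockShift, shift_pow_two_mul, clockShift, pow_zero]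

variable [NeZero n]

lemma clock_pow_two_mul : clock n ^ (2 * n) = 1 := by
  simp only [clock_pow, pow_mul _ (2 * n), root_pow_two_mul, one_pow, Matrix.diagonal_one]

lemma clockShift_add_right (m k : ℕ) : clockShift n m (k + 2 * n) = clockShift n m k := by
  rw [clockShift, pow_add, clock_pow_two_mul, mul_one, clockShift]

lemma clockShift_two_mul_right (m : ℕ) : clockShift n m (2 * n) = clockShift n m 0 := by
  rw [clockShift, clock_pow_two_mul, clockShift, pow_zero]

lemma shift_mul_clock : shift n * clock n = root n • (clock n * shift n) := by
  ext r c
  simp only [clock, Matrix.mul_diagonal, Matrix.smul_apply, Matrix.diagonal_mul, shift,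
    Matrix.of_apply, smul_eq_mul]
  split_ifs with h
  · rw [h, one_mul, mul_one, ← pow_succ', ← pow_eq_pow_mod _ root_pow_two_mul]
  · simp

lemma ad_clock_clockShift (m k : ℕ) :
    ad (clock n) (clockShift n m k) = (1 - root n ^ m) • clockShift n m (k + 1) := by
  have commute : shift n ^ m * clock n = root n ^ m • (clock n * shift n ^ m) := by
    simpa using pow_mul_pow_of_mul_eq_smul shift_mul_clock m 1
  refine (bracketM_of_mem (clock_mem n) (clockShift_mem m k)).trans ?_
  rw [show koszul 0 (m : ZMod 2) = 1 by simp [koszul], one_smul, clockShift,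
    mul_assoc _ _ (clock n), commute, mul_smul_comm, ← mul_assoc, ← mul_assoc, ← pow_succ,
    ← pow_succ', ← clockShift, sub_smul, one_smul]

lemma ad_shift_clockShift (m k : ℕ) :
    ad (shift n) (clockShift n m k) = (root n ^ k - (-1) ^ m) • clockShift n (m + 1) k := by
  have commute : shift n * clock n ^ k = root n ^ k • (clock n ^ k * shift n) := by
    simpa using pow_mul_pow_of_mul_eq_smul shift_mul_clock 1 k
  have sign : koszul 1 (m : ZMod 2) = (-1) ^ m := by simpa using koszul_natCast 1 m
  refine (bracketM_of_mem (shift_mem n) (clockShift_mem m k)).trans ?_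
  rw [sign, clockShift, ← mul_assoc, commute, smul_mul_assoc, mul_assoc, mul_assoc, ← pow_succ,
    ← pow_succ', ← clockShift, sub_smul]

lemma ad_clock_pow_clockShift (m k j : ℕ) :
    (ad (clock n) ^ j) (clockShift n m k) = (1 - root n ^ m) ^ j • clockShift n m (k + j) := by
  induction j with
  | zero => simp
  | succ j ih =>
    rw [pow_succ', Module.End.mul_apply, ih, map_smul, ad_clock_clockShift, smul_smul, ← pow_succ,
      add_assoc]

lemma ad_shift_pow_clockShift (m k j : ℕ) :
    (ad (shift n) ^ j) (clockShift n m k) =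
      (∏ i ∈ Finset.range j, (root n ^ k - (-1) ^ (m + i))) • clockShift n (m + j) k := by
  induction j with
  | zero => simp
  | succ j ih =>
    rw [pow_succ', Module.End.mul_apply, ih, map_smul, ad_shift_clockShift, smul_smul,
      Finset.prod_range_succ, add_assoc]

lemma ad_shift_pow_ad_clock_shift {m : ℕ} (hm : 1 ≤ m) :
    (ad (shift n) ^ (m - 1)) (ad (clock n) (shift n)) = leading n m • clockShift n m 1 := by
  rw [← clockShift_one_zero, ad_clock_clockShift, zero_add, map_smul, clockShift_one_zero,
    ad_shift_pow_clockShift, smul_smul, Nat.add_sub_cancel' hm, pow_one, leading]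

lemma T_clock_shift {m k : ℕ} (hm : 1 ≤ m) (hm' : m < 2 * n) (hk : 1 ≤ k) :
    T n (clock n) (shift n) m k = scale n m k • clockShift n m k := by
  rw [T, if_neg hm'.ne, ad_shift_pow_ad_clock_shift hm, map_smul, ad_clock_pow_clockShift,
    smul_smul, Nat.add_sub_of_le hk, scale]

end matrices

lemma T_two_mul {L : Type*} [AddCommGroup L] [Module ℂ L] [LieSuperalgebra L] {n : ℕ} [NeZero n]
    (d s : L) (k : ℕ) :
    T n d s (2 * n) k = ad s (T n d s (2 * n - 1) k) := by
  have := NeZero.pos n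
  rw [T, T, if_pos rfl, if_neg (by omega), Nat.sub_sub]

section relations

variable {n : ℕ}

lemma ad_shift_clockShift_last [NeZero n] (k : ℕ) :
    ad (shift n) (clockShift n (2 * n - 1) k) = (root n ^ k + 1) • clockShift n (2 * n) k := by
  have := NeZero.pos n
  have sign : (-1 : ℂ) ^ (2 * n - 1) = -1 := Odd.neg_one_pow ⟨n - 1, by omega⟩
  rw [ad_shift_clockShift, sign, sub_neg_eq_add, Nat.sub_add_cancel (by omega)]

lemma T_two_mul_clock_shift [NeZero n] {k : ℕ} (hk : 1 ≤ k) :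
    T n (clock n) (shift n) (2 * n) k =
      (scale n (2 * n - 1) k * (root n ^ k + 1)) • clockShift n (2 * n) k := by
  have := NeZero.pos n
  rw [T_two_mul, T_clock_shift (by omega) (by omega) hk, map_smul, ad_shift_clockShift_last,
    smul_smul]

lemma T_two_mul_half_clock_shift [NeZero n] : T n (clock n) (shift n) (2 * n) n = 0 := by
  rw [T_two_mul_clock_shift (NeZero.pos n), root_pow_half, neg_add_cancel, mul_zero, zero_smul]

lemma scale_last_one [NeZero n] :
    scale n (2 * n - 1) 1 * (root n + 1) = (-1) ^ (n + 1) * (1 - root n ^ 2) ^ n := by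
  obtain ⟨m, hm⟩ := Nat.exists_eq_succ_of_ne_zero (NeZero.ne n)
  rw [scale_one_right, leading_last (NeZero.pos n), ← neg_sub (root n ^ 2) 1,
    neg_pow (root n ^ 2 - 1), ← mul_assoc, ← pow_add, hm, Nat.succ_sub_one, pow_succ _ m,
    Odd.neg_one_pow ⟨m + 1, by omega⟩]
  ring

lemma scale_last_mul (hn : 2 ≤ n) (k : ℕ) :
    scale n (2 * n - 1) k * (root n ^ (2 * k) - 1) =
      (root n ^ 2 - 1) ^ (n - 1) * (root n ^ (2 * k) - 1) *
        ((1 - root n ^ (2 * n - 1)) / (1 - root n)) ^ (k - 1) * scale n 1 k := by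
  have h : (1 - root n) ^ (k - 1) ≠ 0 := pow_ne_zero _ (one_sub_root_ne_zero hn)
  rw [scale, scale, leading_last (by omega), leading_one, pow_one, div_pow]
  field_simp

lemma scale_two_two_mul (hn : 2 ≤ n) :
    2 / (1 - root n ^ 2) ^ (2 * n) * scale n 2 (2 * n) = 2 := by
  have h : 1 - root n ^ 2 ≠ 0 := by
    rw [← neg_sub, neg_ne_zero]; exact root_sq_sub_one_ne_zero hn
  rw [scale, leading_succ le_rfl, leading_one, ← pow_sub_one_mul (by omega : 2 * n ≠ 0)]
  field_simp
  ring

theorem eq_of_relation_clock_shift (hn : 2 ≤ n) {x y : SMat n}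
    (h : Relation n (clock n) (shift n) x y) : x = y := by
  have := neZero_of_two_le hn
  cases h with
  | rel1 => rw [← clockShift_one_zero, ad_clock_pow_clockShift, clockShift_add_right, pow_one]
  | rel2 m h2 hm =>
    rw [ad_shift_pow_ad_clock_shift (by omega), map_smul, ad_clock_pow_clockShift,
      clockShift_add_right, smul_comm]
  | rel3 =>
    rw [← T_two_mul, T_two_mul_clock_shift le_rfl, pow_one, scale_last_one,
      clockShift_two_mul_left, clockShift_zero_one]
  | rel4 k h2 hk =>
    rw [T_two_mul_clock_shift (by omega), T_clock_shift le_rfl (by omega) (by omega), map_smul,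
      clockShift_two_mul_left, ad_shift_clockShift, smul_smul, smul_smul, ← scale_last_mul hn]
    congr 1
    ring
  | rel5 =>
    have square : ad (shift n) (shift n) = (2 : ℂ) • clockShift n 2 0 := by
      have := ad_shift_clockShift (n := n) 1 0
      rwa [clockShift_one_zero, pow_zero, pow_one, sub_neg_eq_add, one_add_one_eq_two] at this
    rw [square, T_clock_shift one_le_two (by omega) (by omega), smul_smul, scale_two_two_mul hn,
      clockShift_two_mul_right]
  | path m k s₁ s₂ h2 hm hk1 hk hs₁ hs =>
    obtain rfl : m = s₁ + s₂ + 1 := by omega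
    rw [T_clock_shift (by omega) (by omega) hk1, T_clock_shift (by omega) (by omega) hk1, map_smul,
      ad_shift_pow_clockShift, smul_smul, smul_smul, coeff_mul_scale hn _ _ _ (by omega),
      add_comm (s₂ + 1), add_assoc]

end relations

end Sylvester

/-! ### The supertrace -/

namespace SuperMatrix

open LieSuperalgebra

variable {n : ℕ}

lemma supertrace_apply (M : SMat n) :
    supertrace n M = ∑ r : Fin (2 * n), (-1) ^ (r : ℕ) * M r r := by
  simp [supertrace]

lemma supertrace_eq_zero_of_mem_part_one {M : SMat n} (hM : M ∈ partM 1) : supertrace n M = 0 := by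
  rw [supertrace_apply]
  refine Finset.sum_eq_zero fun r _ => ?_
  rw [hM r r (par_add_self r ▸ zero_ne_one), mul_zero]

lemma supertrace_mul_comm {i j : ZMod 2} {M N : SMat n} (hM : M ∈ partM i) (hN : N ∈ partM j) :
    supertrace n (M * N) = koszul i j * supertrace n (N * M) := by
  have sign_mul_self (k : ℕ) : (-1 : ℂ) ^ (k * k) = (-1) ^ k :=
    neg_one_pow_congr (by simp [Nat.even_mul])
  simp only [supertrace_apply, Matrix.mul_apply, Finset.mul_sum]
  rw [Finset.sum_comm]
  refine Finset.sum_congr rfl fun c _ => Finset.sum_congr rfl fun r _ => ?_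
  by_cases hi : par r + par c = i
  · by_cases hj : par c + par r = j
    · have sign : koszul i j = (-1) ^ (r : ℕ) * (-1) ^ (c : ℕ) := by
        rw [← hj, ← hi, add_comm (par c), par, par, ← Nat.cast_add, koszul_natCast, sign_mul_self,
          pow_add]
      have sign_sq : (-1 : ℂ) ^ (c : ℕ) * (-1) ^ (c : ℕ) = 1 := by rw [← mul_pow]; simp
      rw [sign]
      linear_combination -(-1) ^ (r : ℕ) * M r c * N c r * sign_sq
    · rw [hN c r hj]; simp
  · rw [hM r c hi]; simp

lemma supertrace_ad (M N : SMat n) : supertrace n (ad M N) = 0 := by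
  have of_mem_part {i j : ZMod 2} {x y : SMat n} (hx : x ∈ (part i : Submodule ℂ (SMat n)))
      (hy : y ∈ (part j : Submodule ℂ (SMat n))) : supertrace n (ad x y) = 0 := by
    rw [show ad x y = _ from bracketM_of_mem hx hy, map_sub, map_smul, supertrace_mul_comm hx hy,
      smul_eq_mul, sub_self]
  obtain ⟨x₀, x₁, h₀, h₁, rfl⟩ := exists_part_add_part M
  obtain ⟨y₀, y₁, k₀, k₁, rfl⟩ := exists_part_add_part N
  simp only [ad] at of_mem_part
  simp only [ad, map_add, LinearMap.add_apply, of_mem_part h₀ k₀, of_mem_part h₀ k₁,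
    of_mem_part h₁ k₀, of_mem_part h₁ k₁, add_zero]

lemma isSubalgebra_sl : IsSubalgebra (sl n) := by
  refine ⟨isGraded_iff.2 fun x₀ _ x₁ h₁ hx => ?_, fun x _ y _ => supertrace_ad x y⟩
  have hx₁ : x₁ ∈ sl n := supertrace_eq_zero_of_mem_part_one h₁
  exact ⟨by simpa using sub_mem hx hx₁, hx₁⟩

end SuperMatrix

/-! ### A basis of `sl(n|n)` -/

lemma span_range_units_smul {ι R M : Type*} [Ring R] [AddCommGroup M] [Module R M] (c : ι → Rˣ)
    (v : ι → M) : Submodule.span R (Set.range (c • v)) = Submodule.span R (Set.range v) := by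
  simp only [Submodule.span_range_eq_iSup, Pi.smul_apply', Submodule.span_singleton_group_smul_eq]

namespace Sylvester

open LieSuperalgebra SuperMatrix

variable {n : ℕ}

section

variable [NeZero n]

lemma clockShift_mod (m k : ℕ) :
    clockShift n (m % (2 * n)) (k % (2 * n)) = clockShift n m k := by
  rw [clockShift, ← pow_eq_pow_mod _ clock_pow_two_mul, ← pow_eq_pow_mod _ shift_pow_two_mul,
    clockShift]

lemma linearIndependent_clockShift :
    LinearIndependent ℂ fun q : Fin (2 * n) × Fin (2 * n) => clockShift n q.1 q.2 := by
  refine Fintype.linearIndependent_iff.2 fun g hg ⟨m, k⟩ => ?_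
  -- The entries in the positions `(r, r + m)` form a Vandermonde system for `k ↦ g (m, k)`.
  have entry (r : Fin (2 * n)) :
      ∑ k : Fin (2 * n), (root n ^ (r : ℕ)) ^ (k : ℕ) * g (m, k) = 0 := by
    have h := congr_fun₂ hg r ⟨(r + m) % (2 * n), Nat.mod_lt _ two_mul_pos⟩
    rw [Fintype.sum_prod_type, Matrix.sum_apply, Finset.sum_eq_single m] at h
    · simpa [Matrix.sum_apply, clockShift_apply, ← pow_mul, mul_comm] using h
    · intro m' _ hm
      rw [Matrix.sum_apply]
      refine Finset.sum_eq_zero fun k' _ => ?_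
      rw [Matrix.smul_apply, clockShift_apply, if_neg, smul_zero]
      intro (h : (r + m : ℕ) ≡ r + m' [MOD 2 * n])
      exact hm (Fin.ext ((h.add_left_cancel' _).symm.eq_of_lt_of_lt m'.2 m.2))
    · simp
  have root_pow_injective : Function.Injective fun r : Fin (2 * n) => root n ^ (r : ℕ) :=
    fun r r' h => Fin.ext (isPrimitiveRoot_root.pow_inj r.2 r'.2 h)
  exact congr_fun (Matrix.eq_zero_of_forall_index_sum_pow_mul_eq_zero root_pow_injective entry) k

lemma linearIndepOn_clockShift : LinearIndepOn ℂ (fun q : ℕ × ℕ => clockShift n q.1 q.2)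
    (Set.Icc (1, 1) (2 * n, 2 * n)) := by
  let residue (k : ℕ) : Fin (2 * n) := ⟨k % (2 * n), Nat.mod_lt _ two_mul_pos⟩
  have residue_injOn : Set.InjOn residue (Set.Icc 1 (2 * n)) := fun k hk l hl h =>
    Nat.mod_injOn_Ico 1 (2 * n) (by simp at hk ⊢; omega) (by simp at hl ⊢; omega) (Fin.ext_iff.1 h)
  have residues_injective : Function.Injective
      fun q : Set.Icc ((1 : ℕ), (1 : ℕ)) (2 * n, 2 * n) => (residue q.1.1, residue q.1.2) :=
    fun ⟨p, hp⟩ ⟨q, hq⟩ h => Subtype.ext <| Prod.ext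
      (residue_injOn ⟨hp.1.1, hp.2.1⟩ ⟨hq.1.1, hq.2.1⟩ (Prod.ext_iff.1 h).1)
      (residue_injOn ⟨hp.1.2, hp.2.2⟩ ⟨hq.1.2, hq.2.2⟩ (Prod.ext_iff.1 h).2)
  simpa only [LinearIndepOn, Function.comp_def, residue, clockShift_mod] using
    linearIndependent_clockShift.comp _ residues_injective

lemma span_clockShift : Submodule.span ℂ
    ((fun q : ℕ × ℕ => clockShift n q.1 q.2) '' Set.Icc (1, 1) (2 * n, 2 * n)) = ⊤ := by
  rw [Set.image_eq_range]
  refine linearIndepOn_clockShift.linearIndependent.span_eq_top_of_card_eq_finrank' ?_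
  simp [Module.finrank_matrix, Finset.card_Icc_prod]

lemma root_pow_add_one_ne_zero {k : ℕ} (hk : k ≤ 2 * n) (hkn : k ≠ n) : root n ^ k + 1 ≠ 0 := by
  intro h
  rcases hk.lt_or_eq with hk | rfl
  · refine hkn (isPrimitiveRoot_root.pow_inj hk (lt_two_mul_self (NeZero.pos n)) ?_)
    rw [root_pow_half, eq_neg_of_add_eq_zero_left h]
  · rw [root_pow_two_mul] at h
    norm_num at h

lemma clockShift_mem_sl {q : ℕ × ℕ} (hq : q ∈ Set.Icc (1, 1) (2 * n, 2 * n) \ {(2 * n, n)}) :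
    clockShift n q.1 q.2 ∈ sl n := by
  obtain ⟨m, k⟩ := q
  obtain ⟨⟨⟨hm, hk⟩, hm', hk'⟩, hne⟩ := hq
  have of_smul_eq_ad {c : ℂ} {M N : SMat n} (hc : c ≠ 0)
      (h : ad M N = c • clockShift n m k) : clockShift n m k ∈ sl n :=
    ((sl n).smul_mem_iff hc).1 (h ▸ supertrace_ad M N)
  rcases hm'.lt_or_eq with hlt | rfl
  · obtain ⟨k, rfl⟩ := Nat.exists_eq_add_of_le' hk
    exact of_smul_eq_ad (one_sub_root_pow_ne_zero hm hlt) (ad_clock_clockShift m k)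
  · exact of_smul_eq_ad (root_pow_add_one_ne_zero hk' fun h => hne (h ▸ rfl))
      (ad_shift_clockShift_last k)

lemma supertrace_clockShift_last_half : supertrace n (clockShift n (2 * n) n) = 2 * n := by
  have entry (r : Fin (2 * n)) : (-1) ^ (r : ℕ) * clockShift n (2 * n) n r r = 1 := by
    rw [clockShift_apply, if_pos (by simp [Nat.mod_eq_of_lt r.2]), pow_mul, root_pow_half,
      ← mul_pow, neg_one_mul, neg_neg, one_pow]
  simp [supertrace_apply, entry]

lemma sl_eq_span_clockShift : sl n = Submodule.span ℂ ((fun q : ℕ × ℕ => clockShift n q.1 q.2) ''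
    (Set.Icc (1, 1) (2 * n, 2 * n) \ {(2 * n, n)})) := by
  have span_le : Submodule.span ℂ ((fun q : ℕ × ℕ => clockShift n q.1 q.2) ''
      (Set.Icc (1, 1) (2 * n, 2 * n) \ {(2 * n, n)})) ≤ sl n :=
    Submodule.span_le.2 (Set.image_subset_iff.2 fun _ => clockShift_mem_sl)
  have half_mem : (2 * n, n) ∈ Set.Icc (1, 1) (2 * n, 2 * n) := by
    have := NeZero.pos n
    simp only [Set.mem_Icc, Prod.mk_le_mk]
    omega
  refine le_antisymm (fun x hx => ?_) span_le
  have hx_span : x ∈ (⊤ : Submodule ℂ (SMat n)) := trivial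
  rw [← span_clockShift, ← Set.insert_sdiff_self_of_mem half_mem, Set.image_insert_eq,
    Submodule.mem_span_insert] at hx_span
  obtain ⟨c, z, hz, rfl⟩ := hx_span
  have hc : c * (2 * n) = 0 := by
    rw [← supertrace_clockShift_last_half, ← smul_eq_mul, ← map_smul]
    exact ((sl n).add_mem_iff_left (span_le hz)).1 hx
  have hn : (2 * n : ℂ) ≠ 0 := mul_ne_zero two_ne_zero (NeZero.ne _)
  rwa [(mul_eq_zero.1 hc).resolve_right hn, zero_smul, zero_add]

end

variable (n) in
/-- The pairs `(m, k)` such that `D^k S^m` is a multiple of the corresponding member of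
`generatorFamily`. Written as `D S^{2n}` and `D^{2n} S`, the two generators take the places that
`indexSet` leaves free. -/
def exponents : Fin 2 ⊕ ↥(indexSet n \ {(2 * n, n)}) → ℕ × ℕ :=
  Sum.elim ![(2 * n, 1), (1, 2 * n)] Subtype.val

lemma exponents_injective : Function.Injective (exponents n) := by
  refine Function.Injective.sumElim (fun i j h => ?_) Subtype.val_injective ?_
  · fin_cases i <;> fin_cases j <;> simp at h ⊢
  · rintro i ⟨⟨m, k⟩, ⟨h1, h2, h3, h4, hS, hD⟩, hne⟩
    fin_cases i
    · rintro ⟨⟩; exact hD rfl rfl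
    · rintro ⟨⟩; exact hS rfl rfl

lemma range_exponents (hn : 2 ≤ n) :
    Set.range (exponents n) = Set.Icc (1, 1) (2 * n, 2 * n) \ {(2 * n, n)} := by
  ext ⟨m, k⟩
  constructor
  · rintro ⟨i | q, h⟩
    · fin_cases i <;> simp [exponents] at h ⊢ <;> omega
    · obtain ⟨h1, h2, h3, h4, -⟩ := q.2.1
      exact h ▸ ⟨⟨⟨h1, h3⟩, h2, h4⟩, q.2.2⟩
  · intro ⟨⟨⟨h1, h3⟩, h2, h4⟩, hne⟩
    by_cases hD : (m, k) = (2 * n, 1)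
    · exact ⟨.inl 0, hD.symm⟩
    by_cases hS : (m, k) = (1, 2 * n)
    · exact ⟨.inl 1, hS.symm⟩
    · refine ⟨.inr ⟨(m, k), ⟨h1, h2, h3, h4, ?_, ?_⟩, hne⟩, rfl⟩
      · rintro rfl rfl; exact hS rfl
      · rintro rfl rfl; exact hD rfl

lemma generatorFamily_clock_shift (hn : 2 ≤ n) : ∃ c : Fin 2 ⊕ ↥(indexSet n \ {(2 * n, n)}) → ℂˣ,
    generatorFamily n (clock n) (shift n) =
      c • ((fun q : ℕ × ℕ => clockShift n q.1 q.2) ∘ exponents n) := by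
  have := neZero_of_two_le hn
  have ne_zero_multiple (i) : ∃ c : ℂˣ, generatorFamily n (clock n) (shift n) i =
      c • clockShift n (exponents n i).1 (exponents n i).2 := by
    rcases i with i | ⟨⟨m, k⟩, ⟨h1, h2, h3, h4, -, -⟩, hne⟩
    · refine ⟨1, ?_⟩
      fin_cases i
      · simp [generatorFamily, exponents, clockShift_two_mul_left, clockShift_zero_one]
      · simp [generatorFamily, exponents, clockShift_two_mul_right, clockShift_one_zero]
    · rcases h2.lt_or_eq with h2 | rfl
      · exact ⟨Units.mk0 _ (scale_ne_zero hn h1 h2 k), T_clock_shift h1 h2 h3⟩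
      · exact ⟨Units.mk0 _ (mul_ne_zero (scale_ne_zero hn (by omega) (by omega) k)
          (root_pow_add_one_ne_zero h4 fun h => hne (h ▸ rfl))), T_two_mul_clock_shift h3⟩
  choose c hc using ne_zero_multiple
  exact ⟨c, funext hc⟩

theorem linearIndependent_generatorFamily (hn : 2 ≤ n) :
    LinearIndependent ℂ (generatorFamily n (clock n) (shift n)) := by
  have := neZero_of_two_le hn
  obtain ⟨c, hc⟩ := generatorFamily_clock_shift hn
  rw [hc]
  refine LinearIndependent.units_smul ?_ c
  rw [← linearIndepOn_range_iff exponents_injective, range_exponents hn]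
  exact linearIndepOn_clockShift.mono Set.sdiff_subset

theorem span_generatorFamily (hn : 2 ≤ n) :
    Submodule.span ℂ (Set.range (generatorFamily n (clock n) (shift n))) = sl n := by
  have := neZero_of_two_le hn
  obtain ⟨c, hc⟩ := generatorFamily_clock_shift hn
  rw [hc, span_range_units_smul, Set.range_comp, range_exponents hn, sl_eq_span_clockShift]

theorem sl_eq_span (hn : 2 ≤ n) : sl n = Submodule.span ℂ ({clock n, shift n} ∪
    (fun q : ℕ × ℕ => T n (clock n) (shift n) q.1 q.2) '' indexSet n) := by
  have := neZero_of_two_le hn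
  have half_mem : (2 * n, n) ∈ indexSet n :=
    ⟨by omega, le_rfl, by omega, by omega, by omega, by omega⟩
  conv_rhs => rw [← Set.insert_sdiff_self_of_mem half_mem, Set.image_insert_eq,
    T_two_mul_half_clock_shift, Set.union_insert, Submodule.span_insert_zero]
  rw [← span_generatorFamily hn, range_generatorFamily]

/-! ### The homomorphism from the free Lie superalgebra -/

lemma toMatrix_ad (x y : Free) : toMatrix n (ad x y) = ad (toMatrix n x) (toMatrix n y) :=
  FreeLieSuper.lift_ad ..

lemma toMatrix_freeD : toMatrix n freeD = clock n := FreeLieSuper.lift_gen ..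

lemma toMatrix_freeS : toMatrix n freeS = shift n := FreeLieSuper.lift_gen ..

lemma toMatrix_comp_generatorFamily :
    toMatrix n ∘ generatorFamily n freeD freeS = generatorFamily n (clock n) (shift n) := by
  rw [map_comp_generatorFamily toMatrix_ad, toMatrix_freeD, toMatrix_freeS]

lemma range_toMatrix_eq_generated :
    LinearMap.range (toMatrix n) = generated {clock n, shift n} := by
  rw [toMatrix, FreeLieSuper.range_lift]
  congr 1
  ext M
  constructor
  · rintro ⟨_ | _, rfl⟩
    exacts [.inl rfl, .inr rfl]
  · rintro (rfl | rfl)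
    exacts [⟨.D, rfl⟩, ⟨.S, rfl⟩]

theorem generated_eq_sl (hn : 2 ≤ n) : generated {clock n, shift n} = sl n := by
  have generator_mem (i) : generatorFamily n (clock n) (shift n) i ∈ sl n :=
    span_generatorFamily hn ▸ Submodule.subset_span ⟨i, rfl⟩
  refine le_antisymm (sInf_le ⟨?_, isSubalgebra_sl⟩) ?_
  · rintro _ (rfl | rfl)
    exacts [generator_mem (.inl 0), generator_mem (.inl 1)]
  · rw [← range_toMatrix_eq_generated, ← span_generatorFamily hn, ← toMatrix_comp_generatorFamily]
    exact Submodule.span_le.2 ((Set.range_comp_subset_range _ _).trans (LinearMap.coe_range _).ge)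

theorem range_toMatrix (hn : 2 ≤ n) : LinearMap.range (toMatrix n) = sl n :=
  range_toMatrix_eq_generated.trans (generated_eq_sl hn)

end Sylvester

/-! ### Fourier analysis of clock-shift systems -/

lemma sum_zmod_eq_sum_range {M : Type*} [AddCommMonoid M] {N : ℕ} [NeZero N] (f : ZMod N → M) :
    ∑ i, f i = ∑ t ∈ Finset.range N, f t :=
  Finset.sum_bij' (fun i _ => i.val) (fun t _ => t)
    (fun i _ => Finset.mem_range.2 (ZMod.val_lt i)) (fun t _ => Finset.mem_univ _)
    (fun i _ => ZMod.natCast_zmod_val i)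
    (fun _ ht => ZMod.val_natCast_of_lt (Finset.mem_range.1 ht))
    (fun i _ => by rw [ZMod.natCast_zmod_val])

lemma eq_of_sum_eq_of_eigen {K V ι : Type*} [Field K] [AddCommGroup V] [Module K V] [Fintype ι]
    (f : Module.End K V) {μ : ι → K} (hμ : Function.Injective μ) {v w : ι → V}
    (hv : ∀ i, f (v i) = μ i • v i) (hw : ∀ i, f (w i) = μ i • w i)
    (h : ∑ i, v i = ∑ i, w i) (i : ι) : v i = w i := by
  have ind : iSupIndep fun i => f.eigenspace (μ i) := f.eigenspaces_iSupIndep.comp hμ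
  exact (iSupIndep_iff_finsetSum_eq_imp_eq _).1 ind Finset.univ v w
    (fun i _ => ⟨Module.End.mem_eigenspace_iff.2 (hv i), Module.End.mem_eigenspace_iff.2 (hw i)⟩)
    h i (Finset.mem_univ i)

namespace Sylvester

open LieSuperalgebra SuperMatrix
open ZMod (stdAddChar injective_stdAddChar dft_apply invDFT_apply)
open scoped ZMod

section fourier

variable {n : ℕ} [NeZero n] {L : Type*} [AddCommGroup L] [Module ℂ L]

lemma stdAddChar_add_natCast (i : ZMod (2 * n)) (k : ℕ) :
    stdAddChar (i + (k : ZMod (2 * n))) = stdAddChar i * root n ^ k := by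
  rw [AddChar.map_add_eq_mul, stdAddChar_natCast]

lemma stdAddChar_add_one (i : ZMod (2 * n)) : stdAddChar (i + 1) = stdAddChar i * root n := by
  simpa using stdAddChar_add_natCast i 1

lemma stdAddChar_sub_one_mul (i : ZMod (2 * n)) : stdAddChar (i - 1) * root n = stdAddChar i := by
  rw [← stdAddChar_add_one, sub_add_cancel]

lemma stdAddChar_ne_zero (i : ZMod (2 * n)) : (stdAddChar i : ℂ) ≠ 0 := by
  rw [← ZMod.natCast_zmod_val i, stdAddChar_natCast]
  exact pow_ne_zero _ (isPrimitiveRoot_root.ne_zero (NeZero.ne _))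

/-- The discrete Fourier transform of `Y m`. For `Y m k = D^k S^m` this is the matrix unit in row
`i` and column `i + m`, both read modulo `2n`. -/
def matUnit (Y : ℕ → ZMod (2 * n) → L) (m : ℕ) (i : ZMod (2 * n)) : L :=
  ((2 * n : ℕ) : ℂ)⁻¹ • 𝓕 (Y m) i

lemma sum_stdAddChar_smul_matUnit (Y : ℕ → ZMod (2 * n) → L) (m : ℕ) (k : ZMod (2 * n)) :
    ∑ i, stdAddChar (i * k) • matUnit Y m i = Y m k := by
  simp only [matUnit, smul_comm _ ((2 * n : ℕ) : ℂ)⁻¹]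
  rw [← Finset.smul_sum, ← invDFT_apply, LinearEquiv.symm_apply_apply]

variable [LieSuperalgebra L]

/-- Elements `Y m k` of a Lie superalgebra on which `d` and `s` act as `D` and `S` act on the
matrices `D^k S^m`. Only the range `1 ≤ m < 2n` is meaningful, and the values of `ad s` on the last
row `m = 2n - 1` are left free apart from `k = 1`. -/
structure ClockShiftSystem (d s : L) (Y : ℕ → ZMod (2 * n) → L) : Prop where
  two_le : 2 ≤ n
  d_mem : d ∈ (part 0 : Submodule ℂ L)
  mem : ∀ (m : ℕ) k, 1 ≤ m → Y m k ∈ (part (m : ZMod 2) : Submodule ℂ L)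
  ad_d : ∀ m k, 1 ≤ m → m < 2 * n → ad d (Y m k) = (1 - root n ^ m) • Y m (k + 1)
  ad_s : ∀ m k, 1 ≤ m → m + 1 < 2 * n → ad s (Y m k) = (stdAddChar k - (-1) ^ m) • Y (m + 1) k
  one_zero : Y 1 0 = s
  ad_s_last : ad s (Y (2 * n - 1) 1) = (root n + 1) • d

namespace ClockShiftSystem

variable {d s : L} {Y : ℕ → ZMod (2 * n) → L} (h : ClockShiftSystem d s Y)

include h

lemma matUnit_mem {m : ℕ} (hm : 1 ≤ m) (i : ZMod (2 * n)) :
    matUnit Y m i ∈ (part (m : ZMod 2) : Submodule ℂ L) :=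
  Submodule.smul_mem _ _ (Submodule.sum_mem _ fun k _ => Submodule.smul_mem _ _ (h.mem m k hm))

lemma sum_matUnit_one : ∑ i, matUnit Y 1 i = s := by
  simpa [h.one_zero] using sum_stdAddChar_smul_matUnit Y 1 0

lemma ad_d_matUnit {m : ℕ} (hm : 1 ≤ m) (hm' : m < 2 * n) (i : ZMod (2 * n)) :
    ad d (matUnit Y m i) = ((1 - root n ^ m) * stdAddChar i) • matUnit Y m i := by
  rw [matUnit, map_smul, smul_comm, dft_apply, map_sum]
  congr 1
  rw [Finset.smul_sum]
  refine Fintype.sum_equiv (Equiv.addRight 1) _ _ fun k => ?_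
  rw [map_smul, h.ad_d m k hm hm', smul_smul, smul_smul, Equiv.coe_addRight,
    show -(k * i) = i + -((k + 1) * i) by ring, AddChar.map_add_eq_mul]
  congr 1
  ring

lemma ad_s_matUnit {m : ℕ} (hm : 1 ≤ m) (hm' : m + 1 < 2 * n) (i : ZMod (2 * n)) :
    ad s (matUnit Y m i) = matUnit Y (m + 1) (i - 1) - (-1 : ℂ) ^ m • matUnit Y (m + 1) i := by
  rw [matUnit, matUnit, matUnit, map_smul, smul_comm ((-1 : ℂ) ^ m), ← smul_sub]
  congr 1
  simp only [dft_apply, map_sum]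
  rw [Finset.smul_sum, ← Finset.sum_sub_distrib]
  refine Finset.sum_congr rfl fun k _ => ?_
  rw [map_smul, h.ad_s m k hm hm', smul_smul, smul_smul, ← sub_smul,
    show -(k * (i - 1)) = -(k * i) + k by ring, AddChar.map_add_eq_mul]
  congr 1
  ring

lemma ad_d_ad_matUnit {m : ℕ} (hm : 1 ≤ m) (hm' : m < 2 * n) (i j : ZMod (2 * n)) :
    ad d (ad (matUnit Y 1 i) (matUnit Y m j)) =
      ((1 - root n) * stdAddChar i + (1 - root n ^ m) * stdAddChar j) •
        ad (matUnit Y 1 i) (matUnit Y m j) := by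
  rw [ad_ad_even h.d_mem (h.matUnit_mem le_rfl i), h.ad_d_matUnit le_rfl (by omega),
    h.ad_d_matUnit hm hm', map_smul, ad_smul_left, ← add_smul, pow_one]

lemma sum_ad_matUnit_one (x : L) : ∑ i, ad (matUnit Y 1 i) x = ad s x := by
  conv_rhs => rw [← h.sum_matUnit_one]
  simp [ad]

-- Both sides are families of eigenvectors of `ad d` with the same, pairwise distinct, eigenvalues,
-- and by `ad_s_matUnit` they have the same sum over `i`.
lemma ad_matUnit_one {m : ℕ} (hm : 1 ≤ m) (hm' : m + 1 < 2 * n) (i j : ZMod (2 * n)) :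
    ad (matUnit Y 1 i) (matUnit Y m j) =
      (if i = j - 1 then matUnit Y (m + 1) (j - 1) else 0) -
        (-1 : ℂ) ^ m • (if i = j + m then matUnit Y (m + 1) j else 0) := by
  refine eq_of_sum_eq_of_eigen (ad d)
    (μ := fun i => (1 - root n) * stdAddChar i + (1 - root n ^ m) * stdAddChar j)
    (v := fun i => ad (matUnit Y 1 i) (matUnit Y m j))
    (w := fun i => (if i = j - 1 then matUnit Y (m + 1) (j - 1) else 0) -
        (-1 : ℂ) ^ m • (if i = j + m then matUnit Y (m + 1) j else 0))
    (fun i i' e => injective_stdAddChar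
      (mul_left_cancel₀ (one_sub_root_ne_zero h.two_le) (add_right_cancel e)))
    (fun i => h.ad_d_ad_matUnit hm (by omega) i j) (fun i => ?_) ?_ i
  · rw [map_sub, map_smul, smul_sub, smul_comm _ ((-1 : ℂ) ^ m)]
    congr 2
    · split_ifs with hi
      · rw [h.ad_d_matUnit (by omega) hm', hi, ← stdAddChar_sub_one_mul j]
        congr 1
        ring
      · simp
    · split_ifs with hi
      · rw [h.ad_d_matUnit (by omega) hm', hi, stdAddChar_add_natCast]
        congr 1
        ring
      · simp
  · rw [h.sum_ad_matUnit_one, h.ad_s_matUnit hm hm', Finset.sum_sub_distrib, ← Finset.smul_sum]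
    simp

lemma ad_matUnit_one_left {m : ℕ} (hm : 1 ≤ m) (hm' : m + 1 < 2 * n) (j : ZMod (2 * n)) :
    ad (matUnit Y 1 (j - 1)) (matUnit Y m j) = matUnit Y (m + 1) (j - 1) := by
  rw [h.ad_matUnit_one hm hm', if_pos rfl, if_neg, smul_zero, sub_zero]
  intro e
  refine zmod_natCast_ne_zero (n := n) (k := m + 1) (by omega) hm' ?_
  push_cast
  linear_combination -e

lemma ad_matUnit_one_right {m : ℕ} (hm : 1 ≤ m) (hm' : m + 1 < 2 * n) (j : ZMod (2 * n)) :
    ad (matUnit Y 1 (j + m)) (matUnit Y m j) = -((-1 : ℂ) ^ m • matUnit Y (m + 1) j) := by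
  rw [h.ad_matUnit_one hm hm', if_neg, if_pos rfl, zero_sub]
  intro e
  refine zmod_natCast_ne_zero (n := n) (k := m + 1) (by omega) hm' ?_
  push_cast
  linear_combination e

lemma ad_matUnit_one_of_ne {m : ℕ} (hm : 1 ≤ m) (hm' : m + 1 < 2 * n) {i j : ZMod (2 * n)}
    (h1 : i ≠ j - 1) (h2 : i ≠ j + m) : ad (matUnit Y 1 i) (matUnit Y m j) = 0 := by
  rw [h.ad_matUnit_one hm hm', if_neg h1, if_neg h2, smul_zero, sub_zero]

lemma ad_ad_matUnit_one_eq_zero {i j : ZMod (2 * n)} {z : L} (h1 : i ≠ j - 1) (h2 : i ≠ j + 1)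
    (hz : ad (matUnit Y 1 i) z = 0) : ad (matUnit Y 1 i) (ad (matUnit Y 1 j) z) = 0 := by
  have hn := h.two_le
  rw [ad_ad (h.matUnit_mem le_rfl i) (h.matUnit_mem le_rfl j), hz,
    h.ad_matUnit_one_of_ne le_rfl (by omega) h1 (by simpa using h2)]
  simp [ad]

lemma ad_matUnit_one_last_self (i : ZMod (2 * n)) :
    ad (matUnit Y 1 i) (matUnit Y (2 * n - 1) i) = 0 := by
  have hn := h.two_le
  have ne {k : ℕ} (h1 : 0 < k) (h2 : k < 2 * n) : i ≠ i - (k : ZMod (2 * n)) := fun e =>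
    zmod_natCast_ne_zero h1 h2 (by linear_combination e)
  have e := h.ad_matUnit_one_right (m := 2 * n - 2) (by omega) (by omega) i
  rw [Even.neg_one_pow ⟨n - 1, by omega⟩, one_smul, show 2 * n - 2 + 1 = 2 * n - 1 by omega,
    natCast_two_mul_sub (by omega), ← sub_eq_add_neg] at e
  rw [← neg_neg (matUnit Y (2 * n - 1) i), ← e, map_neg, neg_eq_zero]
  refine h.ad_ad_matUnit_one_eq_zero ?_ ?_
    (h.ad_matUnit_one_of_ne (by omega) (by omega) ?_ ?_)
  · rw [sub_sub, ← Nat.cast_add_one]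
    exact ne (by omega) (by omega)
  · convert ne one_pos (by omega) using 1
    push_cast
    ring
  · simpa using ne one_pos (by omega)
  · rw [natCast_two_mul_sub (by omega), ← sub_eq_add_neg]
    exact ne two_pos (by omega)

lemma ad_matUnit_one_last_of_ne {i j : ZMod (2 * n)} (h1 : i ≠ j - 1) (h2 : i ≠ j + 1) :
    ad (matUnit Y 1 i) (matUnit Y (2 * n - 1) j) = 0 := by
  have hn := h.two_le
  obtain rfl | h3 := eq_or_ne i j
  · exact h.ad_matUnit_one_last_self i
  have e := h.ad_matUnit_one_left (m := 2 * n - 2) (by omega) (by omega) (j + 1)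
  rw [add_sub_cancel_right, show 2 * n - 2 + 1 = 2 * n - 1 by omega] at e
  rw [← e]
  refine h.ad_ad_matUnit_one_eq_zero h1 h2
    (h.ad_matUnit_one_of_ne (by omega) (by omega) ?_ ?_)
  · rwa [add_sub_cancel_right]
  · rw [natCast_two_mul_sub (by omega)]
    convert h1 using 1
    push_cast
    ring

lemma ad_s_matUnit_last_eq_add (j : ZMod (2 * n)) : ad s (matUnit Y (2 * n - 1) j) =
    ad (matUnit Y 1 (j - 1)) (matUnit Y (2 * n - 1) j) +
      ad (matUnit Y 1 (j + 1)) (matUnit Y (2 * n - 1) j) := by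
  have hn := h.two_le
  rw [← h.sum_ad_matUnit_one]
  refine Fintype.sum_eq_add _ _ (fun e => ?_) fun i hi => h.ad_matUnit_one_last_of_ne hi.1 hi.2
  refine zmod_natCast_ne_zero (n := n) two_pos (by omega) ?_
  push_cast
  linear_combination -e

lemma ad_d_ad_matUnit_pred_last (j : ZMod (2 * n)) :
    ad d (ad (matUnit Y 1 (j - 1)) (matUnit Y (2 * n - 1) j)) = 0 := by
  have hn := h.two_le
  have eigenvalue :
      (1 - root n) * stdAddChar (j - 1) + (1 - root n ^ (2 * n - 1)) * stdAddChar j = 0 := by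
    rw [← stdAddChar_sub_one_mul j]
    linear_combination -stdAddChar (j - 1) * root_mul_root_pow_last (n := n)
  rw [h.ad_d_ad_matUnit (by omega) (by omega), eigenvalue, zero_smul]

-- The relation `[S, T_{2n-1}^1] ∈ ℂ D` enters here: it makes `ad d` kill `ad s (Y (2n-1) 1)`, which
-- is a sum of eigenvectors of `ad d` for the distinct nonzero eigenvalues below and of a vector
-- killed by `ad d`.
lemma ad_matUnit_succ_last (j : ZMod (2 * n)) :
    ad (matUnit Y 1 (j + 1)) (matUnit Y (2 * n - 1) j) = 0 := by
  have hn := h.two_le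
  set κ : ℂ := (1 - root n) * root n + (1 - root n ^ (2 * n - 1))
  have hκ0 : κ ≠ 0 := by
    have root_mul_κ : root n * κ = -((1 - root n) * (1 - root n ^ 2)) := by
      linear_combination -root_mul_root_pow_last (n := n)
    refine right_ne_zero_of_mul (a := root n) ?_
    rw [root_mul_κ, neg_ne_zero]
    exact mul_ne_zero (one_sub_root_ne_zero hn)
      (one_sub_root_pow_ne_zero (m := 2) (by omega) (by omega))
  have eigen (j : ZMod (2 * n)) :
      ad d (ad (matUnit Y 1 (j + 1)) (matUnit Y (2 * n - 1) j)) =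
        (κ * stdAddChar j) • ad (matUnit Y 1 (j + 1)) (matUnit Y (2 * n - 1) j) := by
    rw [h.ad_d_ad_matUnit (by omega) (by omega), stdAddChar_add_one]
    congr 1
    ring
  have sum_eq_zero : ∑ j, (stdAddChar j * (κ * stdAddChar j)) •
      ad (matUnit Y 1 (j + 1)) (matUnit Y (2 * n - 1) j) = ∑ _j : ZMod (2 * n), (0 : L) := by
    have ad_d_eq_zero : ad d (ad s (Y (2 * n - 1) 1)) = 0 := by
      rw [h.ad_s_last, map_smul, ad_self_even h.d_mem, smul_zero]
    rw [Finset.sum_const_zero, ← ad_d_eq_zero, ← sum_stdAddChar_smul_matUnit Y _ 1, map_sum,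
      map_sum]
    refine Finset.sum_congr rfl fun j _ => ?_
    rw [map_smul, map_smul, h.ad_s_matUnit_last_eq_add, map_add, h.ad_d_ad_matUnit_pred_last,
      zero_add, eigen, smul_smul, mul_one]
  have smul_eq_zero' := eq_of_sum_eq_of_eigen (ad d) (μ := fun j => κ * stdAddChar j)
    (fun i i' e => injective_stdAddChar (mul_left_cancel₀ hκ0 e))
    (fun j => by rw [map_smul, eigen, smul_comm]) (by simp) sum_eq_zero j
  exact (smul_eq_zero.1 smul_eq_zero').resolve_left
    (mul_ne_zero (stdAddChar_ne_zero j) (mul_ne_zero hκ0 (stdAddChar_ne_zero j)))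

lemma ad_s_matUnit_last (j : ZMod (2 * n)) : ad s (matUnit Y (2 * n - 1) j) =
    ad (matUnit Y 1 (j - 1)) (matUnit Y (2 * n - 1) j) := by
  rw [h.ad_s_matUnit_last_eq_add, h.ad_matUnit_succ_last, add_zero]

theorem ad_d_ad_s_last (k : ZMod (2 * n)) : ad d (ad s (Y (2 * n - 1) k)) = 0 := by
  rw [← sum_stdAddChar_smul_matUnit Y _ k, map_sum, map_sum]
  refine Finset.sum_eq_zero fun j _ => ?_
  rw [map_smul, map_smul, h.ad_s_matUnit_last, h.ad_d_ad_matUnit_pred_last, smul_zero]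

lemma matUnit_succ_zero {m : ℕ} (hm : 1 ≤ m) (hm' : m + 1 < 2 * n) : matUnit Y (m + 1) 0 =
    -((-1 : ℂ) ^ m • ad (matUnit Y 1 (m : ZMod (2 * n))) (matUnit Y m 0)) := by
  have e := h.ad_matUnit_one_right hm hm' 0
  rw [zero_add] at e
  rw [e, smul_neg, neg_neg, smul_smul, ← mul_pow]
  simp

lemma ad_matUnit_zero {m p : ℕ} (hm : 1 ≤ m) (hp : 1 ≤ p) (hmp : m + p < 2 * n) :
    ad (matUnit Y m 0) (matUnit Y p (-p : ZMod (2 * n))) =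
      -((-1 : ℂ) ^ (m * p) • matUnit Y (m + p) (-p : ZMod (2 * n))) := by
  induction m, hm using Nat.le_induction with
  | base =>
    have e := h.ad_matUnit_one_right hp (by omega) (-p : ZMod (2 * n))
    rw [neg_add_cancel] at e
    rw [e, one_mul, add_comm 1 p]
  | succ m hm ih =>
    have ad_eq_zero :
        ad (matUnit Y 1 (m : ZMod (2 * n))) (matUnit Y p (-p : ZMod (2 * n))) = 0 := by
      refine h.ad_matUnit_one_of_ne hp (by omega) (fun e => ?_) ?_
      · refine zmod_natCast_ne_zero (n := n) (k := m + 1 + p) (by omega) (by omega) ?_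
        push_cast
        linear_combination e
      · rw [neg_add_cancel]
        exact zmod_natCast_ne_zero (by omega) (by omega)
    have ad_right := h.ad_matUnit_one_right (m := m + p) (by omega) (by omega) (-p : ZMod (2 * n))
    rw [show (-p : ZMod (2 * n)) + ((m + p : ℕ) : ZMod (2 * n)) = m by push_cast; ring] at ad_right
    have jacobi := ad_ad_left (h.matUnit_mem le_rfl (m : ZMod (2 * n))) (h.matUnit_mem hm 0)
      (matUnit Y p (-p : ZMod (2 * n)))
    rw [ad_eq_zero, map_zero, smul_zero, sub_zero, ih (by omega), map_neg, map_smul,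
      ad_right] at jacobi
    rw [h.matUnit_succ_zero hm (by omega), ad_neg_left, ad_smul_left, jacobi,
      show m + 1 + p = m + p + 1 by ring]
    simp only [smul_neg, neg_neg, smul_smul]
    rw [← pow_add, ← pow_add, show m + (m * p + (m + p)) = 2 * m + (m + 1) * p by ring,
      pow_add _ (2 * m), pow_mul]
    simp

lemma ad_matUnit_transpose_succ {m p : ℕ} (hm : 1 ≤ m) (hp : 1 ≤ p) (hmp : m + p = 2 * n - 1) :
    ad (matUnit Y (m + 1) 0) (matUnit Y p (m + 1 : ZMod (2 * n))) =
      ad (matUnit Y m 0) (matUnit Y (p + 1) (m : ZMod (2 * n))) + (-1 : ℂ) ^ m •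
        ad (matUnit Y 1 (m : ZMod (2 * n))) (matUnit Y (2 * n - 1) (m + 1 : ZMod (2 * n))) := by
  have neg_cast : (-p : ZMod (2 * n)) = m + 1 := by
    rw [← natCast_two_mul_sub (by omega), show 2 * n - p = m + 1 by omega, Nat.cast_add_one]
  have even : Even (m * p) := by
    rw [Nat.even_mul, Nat.even_iff, Nat.even_iff]
    omega
  have ad_zero := h.ad_matUnit_zero hm hp (by omega)
  rw [neg_cast, even.neg_one_pow, one_smul, hmp] at ad_zero
  have ad_left := h.ad_matUnit_one_left (m := p) (by omega) (by omega) (m + 1)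
  rw [add_sub_cancel_right] at ad_left
  have jacobi := ad_ad_left (h.matUnit_mem le_rfl (m : ZMod (2 * n))) (h.matUnit_mem hm 0)
    (matUnit Y p (m + 1 : ZMod (2 * n)))
  rw [ad_left, ad_zero, map_neg, one_mul] at jacobi
  rw [h.matUnit_succ_zero hm (by omega), ad_neg_left, ad_smul_left, jacobi, smul_sub, smul_smul,
    ← mul_pow, neg_mul_neg, one_mul, one_pow, one_smul, smul_neg]
  abel

lemma ad_matUnit_transpose {m : ℕ} (hm : 1 ≤ m) (hm' : m < 2 * n) :
    ad (matUnit Y m 0) (matUnit Y (2 * n - m) (m : ZMod (2 * n))) =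
      ∑ t ∈ Finset.range m, (-1 : ℂ) ^ t •
        ad (matUnit Y 1 (t : ZMod (2 * n))) (matUnit Y (2 * n - 1) (t + 1 : ZMod (2 * n))) := by
  induction m, hm using Nat.le_induction with
  | base => simp
  | succ m hm ih =>
    rw [Finset.sum_range_succ, ← ih (by omega), show 2 * n - m = 2 * n - (m + 1) + 1 by omega,
      Nat.cast_add_one]
    exact h.ad_matUnit_transpose_succ hm (by omega) (by omega)

-- For `m = 2n - 1` the left side of `ad_matUnit_transpose` is, up to sign, the missing term
-- `t = 2n - 1` of the sum.
lemma sum_ad_matUnit_transpose : ∑ t ∈ Finset.range (2 * n), (-1 : ℂ) ^ t •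
    ad (matUnit Y 1 (t : ZMod (2 * n))) (matUnit Y (2 * n - 1) (t + 1 : ZMod (2 * n))) = 0 := by
  have hn := h.two_le
  have odd : Odd (2 * n - 1) := ⟨n - 1, by omega⟩
  have cast_succ : ((2 * n - 1 : ℕ) : ZMod (2 * n)) + 1 = 0 := by
    rw [← Nat.cast_add_one, Nat.sub_add_cancel (by omega), ZMod.natCast_self]
  have transpose := h.ad_matUnit_transpose (m := 2 * n - 1) (by omega) (by omega)
  rw [show 2 * n - (2 * n - 1) = 1 by omega,
    ad_skew (h.matUnit_mem (by omega) _) (h.matUnit_mem le_rfl _), mul_one,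
    odd.neg_one_pow] at transpose
  rw [show Finset.range (2 * n) = Finset.range (2 * n - 1 + 1) by congr 1; omega,
    Finset.sum_range_succ, ← transpose, odd.neg_one_pow, cast_succ]
  simp

theorem ad_s_last_half : ad s (Y (2 * n - 1) (n : ZMod (2 * n))) = 0 := by
  rw [← sum_stdAddChar_smul_matUnit Y, map_sum, ← neg_eq_zero, ← h.sum_ad_matUnit_transpose,
    ← Finset.sum_neg_distrib, ← Equiv.sum_comp (Equiv.addRight 1), sum_zmod_eq_sum_range]
  refine Finset.sum_congr rfl fun t _ => ?_
  have char_eq : stdAddChar ((t + 1) * n : ZMod (2 * n)) = -(-1 : ℂ) ^ t := by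
    rw [← Nat.cast_add_one, ← Nat.cast_mul, stdAddChar_natCast, mul_comm, pow_mul, root_pow_half,
      pow_succ, mul_neg_one]
  rw [Equiv.coe_addRight, map_smul, h.ad_s_matUnit_last, add_sub_cancel_right, char_eq, neg_smul,
    neg_neg]

end ClockShiftSystem

end fourier

/-! ### Consequences of the relations -/

section consequences

variable {n : ℕ} {L : Type*} [AddCommGroup L] [Module ℂ L] [LieSuperalgebra L] {d s : L}

lemma ad_d_T {m k : ℕ} (hm : m < 2 * n) (hk : 1 ≤ k) : ad d (T n d s m k) = T n d s m (k + 1) := by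
  obtain ⟨k, rfl⟩ := Nat.exists_eq_add_of_le' hk
  rw [T, T, if_neg hm.ne, if_neg hm.ne, Nat.add_sub_cancel, Nat.add_sub_cancel, pow_succ',
    Module.End.mul_apply]

lemma exists_natCast_eq [NeZero n] (k : ZMod (2 * n)) : ∃ j : ℕ, 1 ≤ j ∧ j ≤ 2 * n ∧ j = k := by
  refine ⟨(k - 1).val + 1, Nat.le_add_left 1 _, ZMod.val_lt (k - 1), ?_⟩
  rw [Nat.cast_add_one, ZMod.natCast_zmod_val, sub_add_cancel]

/-- The elements `T_m^k` for `1 ≤ m < 2n`, rescaled so as to play the role of the matrices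
`D^k S^m`. The exponent `k` is read modulo `2n`, with representatives `1, …, 2n`. -/
def normalizedT (n : ℕ) (d s : L) (m : ℕ) (k : ZMod (2 * n)) : L :=
  (scale n m ((k - 1).val + 1))⁻¹ • (ad d ^ (k - 1).val) ((ad s ^ (m - 1)) (ad d s))

/-- The relations hold for the even element `d` and the odd element `s`. -/
structure SatisfiesRelations (n : ℕ) (d s : L) : Prop where
  two_le : 2 ≤ n
  d_mem : d ∈ (part 0 : Submodule ℂ L)
  s_mem : s ∈ (part 1 : Submodule ℂ L)
  eq_of_relation : ∀ x y, Relation n d s x y → x = y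

namespace SatisfiesRelations

section action

variable (h : SatisfiesRelations n d s)

include h

lemma ad_d_pow_two_mul {m : ℕ} (hm : 1 ≤ m) (hm' : m < 2 * n) :
    (ad d ^ (2 * n)) ((ad s ^ (m - 1)) (ad d s)) =
      (1 - root n ^ m) ^ (2 * n) • (ad s ^ (m - 1)) (ad d s) := by
  rcases hm.eq_or_lt with rfl | hm
  · rw [Nat.sub_self, pow_zero, Module.End.one_apply, ← Module.End.mul_apply, ← pow_succ, pow_succ',
      Module.End.mul_apply, h.eq_of_relation _ _ .rel1, map_smul, pow_one]
  · exact h.eq_of_relation _ _ (.rel2 m hm (by omega))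

lemma ad_d_pow_two_mul_mul {m : ℕ} (hm : 1 ≤ m) (hm' : m < 2 * n) (t : ℕ) :
    (ad d ^ (2 * n * t)) ((ad s ^ (m - 1)) (ad d s)) =
      (1 - root n ^ m) ^ (2 * n * t) • (ad s ^ (m - 1)) (ad d s) := by
  induction t with
  | zero => simp
  | succ t ih =>
    rw [mul_add_one, pow_add, Module.End.mul_apply, h.ad_d_pow_two_mul hm hm', map_smul, ih,
      smul_smul, ← pow_add, add_comm]

lemma T_eq {m k : ℕ} (hm : 1 ≤ m) (hm' : m < 2 * n) (hk : 1 ≤ k) :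
    T n d s m k = scale n m k • normalizedT n d s m k := by
  have := neZero_of_two_le h.two_le
  obtain ⟨k, rfl⟩ := Nat.exists_eq_add_of_le' hk
  have exponent : ((k + 1 : ℕ) - 1 : ZMod (2 * n)).val = k % (2 * n) := by
    rw [Nat.cast_add_one, add_sub_cancel_right, ZMod.val_natCast]
  have scale_eq : scale n m (k + 1) =
      (1 - root n ^ m) ^ (2 * n * (k / (2 * n))) * scale n m (k % (2 * n) + 1) := by
    conv_lhs => rw [← Nat.mod_add_div k (2 * n)]
    rw [scale, scale, Nat.add_sub_cancel, Nat.add_sub_cancel, pow_add]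
    ring
  rw [T, if_neg hm'.ne, normalizedT, exponent, scale_eq, Nat.add_sub_cancel, smul_smul,
    mul_inv_cancel_right₀ (scale_ne_zero h.two_le hm hm' _), ← map_smul,
    ← h.ad_d_pow_two_mul_mul hm hm', ← Module.End.mul_apply (ad d ^ _) (ad d ^ _), ← pow_add,
    Nat.mod_add_div]

lemma ad_s_T {m k : ℕ} (hm : 1 ≤ m) (hm' : m + 1 < 2 * n) (hk : 1 ≤ k) (hk' : k ≤ 2 * n) :
    ad s (T n d s m k) = coeff n k 1 (m - 1) • T n d s (m + 1) k := by
  have path := h.eq_of_relation _ _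
    (.path (m + 1) k 1 (m - 1) (by omega) (by omega) hk hk' le_rfl (by omega))
  rwa [Nat.sub_add_cancel hm, pow_one] at path

lemma ad_s_pow_mem {m : ℕ} (hm : 1 ≤ m) :
    (ad s ^ (m - 1)) (ad d s) ∈ (part (m : ZMod 2) : Submodule ℂ L) := by
  induction m, hm using Nat.le_induction with
  | base => simpa using ad_mem h.d_mem h.s_mem
  | succ m hm ih =>
    obtain ⟨m, rfl⟩ := Nat.exists_eq_add_of_le' hm
    rw [Nat.add_sub_cancel] at ih ⊢
    rw [pow_succ', Module.End.mul_apply, Nat.cast_succ (m + 1), add_comm]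
    exact ad_mem h.s_mem ih

lemma ad_d_pow_mem {i : ZMod 2} {x : L} (hx : x ∈ part i) (k : ℕ) :
    (ad d ^ k) x ∈ (part i : Submodule ℂ L) := by
  induction k with
  | zero => simpa using hx
  | succ k ih =>
    rw [pow_succ', Module.End.mul_apply]
    simpa using ad_mem h.d_mem ih

lemma ad_d_normalizedT {m : ℕ} (hm : 1 ≤ m) (hm' : m < 2 * n) (k : ZMod (2 * n)) :
    ad d (normalizedT n d s m k) = (1 - root n ^ m) • normalizedT n d s m (k + 1) := by
  have := neZero_of_two_le h.two_le
  obtain ⟨k, hk, -, rfl⟩ := exists_natCast_eq k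
  have scale_succ : scale n m (k + 1) = scale n m k * (1 - root n ^ m) := by
    rw [scale, scale, Nat.add_sub_cancel, mul_assoc, pow_sub_one_mul (by omega)]
  refine smul_right_injective L (scale_ne_zero h.two_le hm hm' k) ?_
  beta_reduce
  rw [← map_smul, ← h.T_eq hm hm' hk, ad_d_T hm' hk, h.T_eq hm hm' (by omega), Nat.cast_add_one,
    smul_smul, scale_succ]

lemma ad_s_normalizedT [NeZero n] {m : ℕ} (hm : 1 ≤ m) (hm' : m + 1 < 2 * n) (k : ZMod (2 * n)) :
    ad s (normalizedT n d s m k) =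
      (stdAddChar k - (-1) ^ m) • normalizedT n d s (m + 1) k := by
  obtain ⟨k, hk, hk', rfl⟩ := exists_natCast_eq k
  have coeff_eq : coeff n k 1 (m - 1) * scale n (m + 1) k =
      scale n m k * (root n ^ k - (-1) ^ m) := by
    simpa [show 1 + (m - 1) + 1 = m + 1 by omega, Nat.sub_add_cancel hm] using
      coeff_mul_scale h.two_le k 1 (m - 1) (by omega)
  refine smul_right_injective L (scale_ne_zero h.two_le hm (by omega) k) ?_
  beta_reduce
  rw [← map_smul, ← h.T_eq hm (by omega) hk, h.ad_s_T hm hm' hk hk', h.T_eq (by omega) hm' hk,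
    smul_smul, smul_smul, coeff_eq, stdAddChar_natCast]

lemma normalizedT_one_zero [NeZero n] : normalizedT n d s 1 0 = s := by
  refine smul_right_injective L (scale_ne_zero h.two_le le_rfl (by linarith [h.two_le]) (2 * n)) ?_
  beta_reduce
  have T_one : T n d s 1 (2 * n) = (ad d ^ (2 * n)) s := by
    rw [T, if_neg (by omega), Nat.sub_self, pow_zero, Module.End.one_apply,
      ← pow_sub_one_mul (NeZero.ne (2 * n)), Module.End.mul_apply]
  rw [← ZMod.natCast_self, ← h.T_eq le_rfl (by linarith [h.two_le]) two_mul_pos, T_one,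
    h.eq_of_relation _ _ .rel1, scale, leading_one, pow_one, mul_pow_sub_one (NeZero.ne _)]

lemma ad_s_normalizedT_last [NeZero n] :
    ad s (normalizedT n d s (2 * n - 1) 1) = (root n + 1) • d := by
  have hn := h.two_le
  refine smul_right_injective L (scale_ne_zero hn (by omega) (m := 2 * n - 1) (by omega) 1) ?_
  beta_reduce
  rw [← map_smul, ← Nat.cast_one (R := ZMod (2 * n)), ← h.T_eq (by omega) (by omega) le_rfl,
    h.eq_of_relation _ _ .rel3, smul_smul, scale_last_one]

theorem clockShiftSystem [NeZero n] : ClockShiftSystem d s (normalizedT n d s) where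
  two_le := h.two_le
  d_mem := h.d_mem
  mem _ _ hm := Submodule.smul_mem _ _ (h.ad_d_pow_mem (h.ad_s_pow_mem hm) _)
  ad_d _ k hm hm' := h.ad_d_normalizedT hm hm' k
  ad_s _ k hm hm' := h.ad_s_normalizedT hm hm' k
  one_zero := h.normalizedT_one_zero
  ad_s_last := h.ad_s_normalizedT_last

lemma T_two_mul_eq [NeZero n] {k : ℕ} (hk : 1 ≤ k) : T n d s (2 * n) k =
    scale n (2 * n - 1) k • ad s (normalizedT n d s (2 * n - 1) k) := by
  have hn := h.two_le
  rw [T_two_mul, h.T_eq (by omega) (by omega) hk, map_smul]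

end action

section span

variable [NeZero n] (h : SatisfiesRelations n d s)

include h

lemma T_mem_span_of_le {m k : ℕ} (hm : 1 ≤ m) (hm' : m ≤ 2 * n) (hk : 1 ≤ k) (hk' : k ≤ 2 * n) :
    T n d s m k ∈ Submodule.span ℂ (Set.range (generatorFamily n d s)) := by
  have hn := h.two_le
  have hY := h.clockShiftSystem
  by_cases isS : m = 1 ∧ k = 2 * n
  · obtain ⟨rfl, rfl⟩ := isS
    rw [h.T_eq le_rfl (by omega) hk, ZMod.natCast_self, hY.one_zero]
    exact Submodule.smul_mem _ _ (Submodule.subset_span ⟨.inl 1, rfl⟩)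
  by_cases isD : m = 2 * n ∧ k = 1
  · obtain ⟨rfl, rfl⟩ := isD
    rw [h.T_two_mul_eq hk, Nat.cast_one, hY.ad_s_last]
    exact Submodule.smul_mem _ _ (Submodule.smul_mem _ _ (Submodule.subset_span ⟨.inl 0, rfl⟩))
  by_cases isZero : m = 2 * n ∧ k = n
  · obtain ⟨rfl, hk⟩ := isZero
    rw [h.T_two_mul_eq (by omega), hk, hY.ad_s_last_half, smul_zero]
    exact zero_mem _
  have index_mem : (m, k) ∈ indexSet n \ {(2 * n, n)} :=
    ⟨⟨hm, hm', hk, hk', fun a b => isS ⟨a, b⟩, fun a b => isD ⟨a, b⟩⟩, by simpa using isZero⟩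
  exact Submodule.subset_span ⟨.inr ⟨(m, k), index_mem⟩, rfl⟩

lemma T_mem_span {m k : ℕ} (hm : 1 ≤ m) (hm' : m < 2 * n) (hk : 1 ≤ k) :
    T n d s m k ∈ Submodule.span ℂ (Set.range (generatorFamily n d s)) := by
  obtain ⟨j, hj, hj', e⟩ := exists_natCast_eq (k : ZMod (2 * n))
  have T_mem := h.T_mem_span_of_le hm hm'.le hj hj'
  rw [h.T_eq hm hm' hj, Submodule.smul_mem_iff _ (scale_ne_zero h.two_le hm hm' j), e] at T_mem
  rw [h.T_eq hm hm' hk]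
  exact Submodule.smul_mem _ _ T_mem

lemma ad_d_generatorFamily_mem_span (i : Fin 2 ⊕ ↥(indexSet n \ {(2 * n, n)})) :
    ad d (generatorFamily n d s i) ∈ Submodule.span ℂ (Set.range (generatorFamily n d s)) := by
  obtain i | ⟨⟨m, k⟩, ⟨hm, hm', hk, -⟩, -⟩ := i
  · fin_cases i
    · change ad d d ∈ _
      rw [ad_self_even h.d_mem]
      exact zero_mem _
    · have T_one_one : T n d s 1 1 = ad d s := if_neg (by have := h.two_le; omega)
      exact T_one_one ▸ h.T_mem_span le_rfl (by linarith [h.two_le]) le_rfl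
  · change ad d (T n d s m k) ∈ _
    obtain hm' | rfl : m < 2 * n ∨ m = 2 * n := hm'.lt_or_eq
    · rw [ad_d_T hm' hk]
      exact h.T_mem_span hm hm' (Nat.le_add_left 1 k)
    · rw [h.T_two_mul_eq hk, map_smul, h.clockShiftSystem.ad_d_ad_s_last, smul_zero]
      exact zero_mem _

lemma ad_s_T_mem_span {m k : ℕ} (hm : 1 ≤ m) (hm' : m ≤ 2 * n) (hk : 1 ≤ k) (hk' : k ≤ 2 * n)
    (hmk : m = 2 * n → k ≠ 1) :
    ad s (T n d s m k) ∈ Submodule.span ℂ (Set.range (generatorFamily n d s)) := by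
  have hn := h.two_le
  obtain hlt | rfl | rfl : m + 1 < 2 * n ∨ m = 2 * n - 1 ∨ m = 2 * n := by omega
  · rw [h.ad_s_T hm hlt hk hk']
    exact Submodule.smul_mem _ _ (h.T_mem_span (by omega) hlt hk)
  · rw [← T_two_mul]
    exact h.T_mem_span_of_le (by omega) le_rfl hk hk'
  · rw [h.eq_of_relation _ _ (.rel4 k (by have := hmk rfl; omega) hk')]
    exact Submodule.smul_mem _ _ (h.T_mem_span le_rfl (by omega) hk)

lemma ad_s_generatorFamily_mem_span (i : Fin 2 ⊕ ↥(indexSet n \ {(2 * n, n)})) :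
    ad s (generatorFamily n d s i) ∈ Submodule.span ℂ (Set.range (generatorFamily n d s)) := by
  obtain i | ⟨⟨m, k⟩, ⟨hm, hm', hk, hk', -, hmk⟩, -⟩ := i
  · fin_cases i
    · change ad s d ∈ _
      rw [ad_skew (m := 1) (p := 0) (by simpa using h.s_mem) (by simpa using h.d_mem)]
      exact neg_mem (Submodule.smul_mem _ _ (h.ad_d_generatorFamily_mem_span (.inl 1)))
    · change ad s s ∈ _
      rw [h.eq_of_relation _ _ .rel5]
      exact Submodule.smul_mem _ _
        (h.T_mem_span one_le_two (by linarith [h.two_le]) two_mul_pos)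
  · exact h.ad_s_T_mem_span hm hm' hk hk' hmk

end span

end SatisfiesRelations

end consequences

end Sylvester

/-! ### The kernel -/

lemma ker_eq_of_linearIndependent_comp {K V W ι : Type*} [Ring K] [AddCommGroup V] [Module K V]
    [AddCommGroup W] [Module K W] {f : V →ₗ[K] W} {I : Submodule K V} {v : ι → V}
    (hI : I ≤ LinearMap.ker f) (hv : LinearIndependent K (f ∘ v))
    (hspan : I ⊔ Submodule.span K (Set.range v) = ⊤) : LinearMap.ker f = I := by
  have disjoint : Disjoint (Submodule.span K (Set.range v)) (LinearMap.ker f) :=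
    Submodule.range_ker_disjoint hv
  calc LinearMap.ker f = (I ⊔ Submodule.span K (Set.range v)) ⊓ LinearMap.ker f := by
        rw [hspan, top_inf_eq]
    _ = I := by rw [sup_inf_assoc_of_le _ hI, disjoint.eq_bot, sup_bot_eq]

namespace Sylvester

open LieSuperalgebra SuperMatrix

lemma freeD_mem : freeD ∈ (part 0 : Submodule ℂ Free) := FreeLieSuper.gen_mem_part letterParity .D

lemma freeS_mem : freeS ∈ (part 1 : Submodule ℂ Free) := FreeLieSuper.gen_mem_part letterParity .S

lemma satisfiesRelations_map {n : ℕ} {L : Type*} [AddCommGroup L] [Module ℂ L] [LieSuperalgebra L]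
    (hn : 2 ≤ n) {f : Free →ₗ[ℂ] L} (hp : ∀ i, ∀ x : Free, x ∈ part i → f x ∈ part i)
    (hf : ∀ x y, f (ad x y) = ad (f x) (f y))
    (h : ∀ x y, Relation n freeD freeS x y → f x = f y) :
    SatisfiesRelations n (f freeD) (f freeS) where
  two_le := hn
  d_mem := hp 0 freeD freeD_mem
  s_mem := hp 1 freeS freeS_mem
  eq_of_relation _ _ image_relation := by
    obtain ⟨x, y, hxy, rfl, rfl⟩ := (relation_map_iff hf).1 image_relation
    exact h x y hxy

lemma comap_span_generatorFamily {n : ℕ} {L : Type*} [AddCommGroup L] [Module ℂ L]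
    [LieSuperalgebra L] {f : Free →ₗ[ℂ] L} (hf : ∀ x y, f (ad x y) = ad (f x) (f y))
    (h : SatisfiesRelations n (f freeD) (f freeS)) :
    (Submodule.span ℂ (Set.range (generatorFamily n (f freeD) (f freeS)))).comap f = ⊤ := by
  have := neZero_of_two_le h.two_le
  refine FreeLieSuper.eq_top_of_ad_gen_mem letterParity ?_ ?_
  · rintro (_ | _)
    exacts [Submodule.subset_span ⟨.inl 0, rfl⟩, Submodule.subset_span ⟨.inl 1, rfl⟩]
  · rintro (_ | _) y hy <;> rw [Submodule.mem_comap, hf]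
    exacts [ad_mem_span h.ad_d_generatorFamily_mem_span hy,
      ad_mem_span h.ad_s_generatorFamily_mem_span hy]

lemma idealGenerated_le_ker_toMatrix {n : ℕ} (hn : 2 ≤ n) :
    idealGenerated {z | ∃ x y, Relation n freeD freeS x y ∧ z = x - y} ≤
      LinearMap.ker (toMatrix n) := by
  refine sInf_le ⟨?_, isIdeal_ker (FreeLieSuper.lift_mem_part _ _ _) toMatrix_ad⟩
  rintro _ ⟨x, y, hxy, rfl⟩
  have relation : Relation n (clock n) (shift n) (toMatrix n x) (toMatrix n y) := by
    rw [← toMatrix_freeD, ← toMatrix_freeS]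
    exact (relation_map_iff toMatrix_ad).2 ⟨x, y, hxy, rfl, rfl⟩
  rw [SetLike.mem_coe, LinearMap.mem_ker, map_sub, sub_eq_zero]
  exact eq_of_relation_clock_shift hn relation

lemma idealGenerated_sup_span_generatorFamily {n : ℕ} (hn : 2 ≤ n) :
    idealGenerated {z | ∃ x y, Relation n freeD freeS x y ∧ z = x - y} ⊔
      Submodule.span ℂ (Set.range (generatorFamily n freeD freeS)) = ⊤ := by
  set R : Set Free := {z | ∃ x y, Relation n freeD freeS x y ∧ z = x - y}
  let _ := quotient (idealGenerated R) (isIdeal_idealGenerated R)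
  have mkQ_ad (x y : Free) : (idealGenerated R).mkQ (ad x y) =
      ad ((idealGenerated R).mkQ x) ((idealGenerated R).mkQ y) := rfl
  have relations : SatisfiesRelations n ((idealGenerated R).mkQ freeD)
      ((idealGenerated R).mkQ freeS) :=
    satisfiesRelations_map hn (fun _ x hx => ⟨x, hx, rfl⟩) mkQ_ad fun x y hxy =>
      (Submodule.Quotient.eq _).2 (subset_idealGenerated R ⟨x, y, hxy, rfl⟩)
  rw [← Submodule.comap_map_mkQ, Submodule.map_span, ← Set.range_comp,
    map_comp_generatorFamily mkQ_ad]
  exact comap_span_generatorFamily mkQ_ad relations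

theorem ker_toMatrix {n : ℕ} (hn : 2 ≤ n) : LinearMap.ker (toMatrix n) =
    idealGenerated {z | ∃ x y, Relation n freeD freeS x y ∧ z = x - y} := by
  have independent := linearIndependent_generatorFamily hn
  rw [← toMatrix_comp_generatorFamily] at independent
  exact ker_eq_of_linearIndependent_comp (idealGenerated_le_ker_toMatrix hn) independent
    (idealGenerated_sup_span_generatorFamily hn)

end Sylvester

end

theorem theorem2 (n : ℕ) (hn : 2 ≤ n) :
    -- `D` is even, `S` is odd, and together they generate `sl(n|n)`
    SuperMatrix.clock n ∈ (LieSuperalgebra.part 0 : Submodule ℂ (SuperMatrix.SMat n)) ∧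
    SuperMatrix.shift n ∈ (LieSuperalgebra.part 1 : Submodule ℂ (SuperMatrix.SMat n)) ∧
    LieSuperalgebra.generated {SuperMatrix.clock n, SuperMatrix.shift n} = SuperMatrix.sl n ∧
    -- `sl(n|n)` is spanned by `D`, `S` and the `T_m^k`
    SuperMatrix.sl n = Submodule.span ℂ
      ({SuperMatrix.clock n, SuperMatrix.shift n} ∪
        (fun q : ℕ × ℕ => Sylvester.T n (SuperMatrix.clock n) (SuperMatrix.shift n) q.1 q.2) ''
          Sylvester.indexSet n) ∧
    -- of these, `T_(2n)^n` is zero, and the others form a basis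
    Sylvester.T n (SuperMatrix.clock n) (SuperMatrix.shift n) (2 * n) n = 0 ∧
    LinearIndependent ℂ
      (Sum.elim ![SuperMatrix.clock n, SuperMatrix.shift n]
        (fun q : ↥(Sylvester.indexSet n \ {(2 * n, n)}) =>
          Sylvester.T n (SuperMatrix.clock n) (SuperMatrix.shift n) q.1.1 q.1.2)) ∧
    -- the relations hold, and they are defining: `sl(n|n)` is the image of the free Lie
    -- superalgebra, and the kernel is the ideal generated by the relations
    (∀ x y, Sylvester.Relation n (SuperMatrix.clock n) (SuperMatrix.shift n) x y → x = y) ∧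
    LinearMap.range (Sylvester.toMatrix n) = SuperMatrix.sl n ∧
    LinearMap.ker (Sylvester.toMatrix n) =
      LieSuperalgebra.idealGenerated
        {z | ∃ x y, Sylvester.Relation n Sylvester.freeD Sylvester.freeS x y ∧ z = x - y} := by
  have := Sylvester.neZero_of_two_le hn
  exact ⟨SuperMatrix.clock_mem n, SuperMatrix.shift_mem n, Sylvester.generated_eq_sl hn,
    Sylvester.sl_eq_span hn, Sylvester.T_two_mul_half_clock_shift,
    Sylvester.linearIndependent_generatorFamily hn,
    fun _ _ => Sylvester.eq_of_relation_clock_shift hn, Sylvester.range_toMatrix hn,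
    Sylvester.ker_toMatrix hn⟩
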